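/- **Proposition 3.7 (Reparameterization).** Let $d\ge 2$ and let $A\subset\mathbb{R}^d$ be bounded with $A=\overline{A^\circ}$, and suppose that $A$ has a $C^{1,1}$ boundary: each $x\in\partial A$ has a neighbourhood $U$ such that $\partial A\cap U$, after a rotation, is the graph of a real-valued function that is defined on an open subset of $\mathbb{R}^{d-1}$ and is differentiable there with Lipschitz continuous derivative. For $z\in\partial A$ let $\hat n_z$ be the unit normal to $\partial A$ at $z$ pointing inside $A$. Let $dz$ denote surface measure on $\partial A$, i.e. $(d-1)$-dimensional Hausdorff measure (normalized to agree with Lebesgue measure on $\mathbb{R}^{d-1}$), let $|\partial A|$ be the total surface measure of $\partial A$, and for $r>0$ let $\partial A^{(r)}:=A\cap\bigcup_{x\in\partial A}\{y:\|y-x\|<r\}$. Then $|\partial A|<\infty$, and there are constants $c=c(A)$ and $r_0=r_0(A)$ in $(0,\infty)$ such that $z+s\hat n_z\in A$ for all $z\in\partial A$ and $s\in[0,r_0]$, and such that for all $r\in(0,r_0)$ and all bounded (Borel) measurable $\psi:A\to[0,\infty)$ the integrals below exist and $$\Big|\int_{\partial A^{(r)}}\psi(y)\,dy-\int_0^r\!\int_{\partial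 A}\psi(z+s\hat n_z)\,dz\,ds\Big|\le c\,r\int_0^r\!\int_{\partial A}\psi(z+s\hat n_z)\,dz\,ds .$$ If, moreover, $\psi(y)$ depends only on $\mathrm{dist}(y,\partial A)$, i.e. there is a real-valued function $\Psi$ with $\psi(z+s\hat n_z)=\Psi(s)$ for all $(z,s)\in\partial A\times(0,r_0)$, then (with the same $c$ and $r_0$; $\Psi$ is integrable on $(0,r)$ if $A\neq\emptyset$) $$\Big|\int_{\partial A^{(r)}}\psi(y)\,dy-|\partial A|\int_0^r\Psi(s)\,ds\Big|\le c\,r\,|\partial A|\int_0^r\Psi(s)\,ds ,$$ where for $A=\emptyset$ the terms with the factor $|\partial A|=0$ are read as $0$. -/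

import Mathlib

open MeasureTheory Set Filter Topology

/-- `A ⊆ ℝ^d` has a `C^{1,1}` boundary: every `x ∈ ∂A` has a neighbourhood `U` such that `∂A ∩ U` is,
after a rotation `R` (and the identification of `ℝ^d` with `ℝ^{d-1} × ℝ`, Euclidean norms), the graph
of a function `f` that is differentiable with Lipschitz derivative on an open set `V ⊆ ℝ^{d-1}`. -/
def HasC11Boundary {d : ℕ} (A : Set (EuclideanSpace ℝ (Fin d))) : Prop :=
  ∀ x ∈ frontier A, ∃ U ∈ 𝓝 x,
    ∃ R : EuclideanSpace ℝ (Fin d) ≃ₗᵢ[ℝ] WithLp 2 (EuclideanSpace ℝ (Fin (d - 1)) × ℝ),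
    ∃ V : Set (EuclideanSpace ℝ (Fin (d - 1))), IsOpen V ∧
    ∃ f : EuclideanSpace ℝ (Fin (d - 1)) → ℝ,
      DifferentiableOn ℝ f V ∧ (∃ K : NNReal, LipschitzOnWith K (fderiv ℝ f) V) ∧
      frontier A ∩ U = {y | (R y).fst ∈ V ∧ (R y).snd = f (R y).fst}

/-- `v` is a unit vector, normal to `∂A` at `z` (orthogonal to all tangent vectors of `∂A` at `z`),
and pointing inside `A`. -/
def IsInnerUnitNormal {d : ℕ} (A : Set (EuclideanSpace ℝ (Fin d)))
    (z v : EuclideanSpace ℝ (Fin d)) : Prop :=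
  ‖v‖ = 1 ∧ (∀ w ∈ tangentConeAt ℝ (frontier A) z, inner ℝ v w = 0) ∧
    ∀ᶠ s : ℝ in 𝓝[>] 0, z + s • v ∈ A

/-- The inner unit normal `n̂_z` to `∂A` at `z ∈ ∂A`. It is unique for the sets considered here;
the value is arbitrary at points `z` at which there is no such vector. -/
noncomputable def innerNormal {d : ℕ} (A : Set (EuclideanSpace ℝ (Fin d)))
    (z : EuclideanSpace ℝ (Fin d)) : EuclideanSpace ℝ (Fin d) :=
  Classical.epsilon fun v => IsInnerUnitNormal A z v

/-- The boundary layer `∂A^{(r)} = A ∩ ⋃_{x ∈ ∂A} B(x, r)°`, with `B(x, r)°` the open ball. -/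
def boundaryLayer {d : ℕ} (A : Set (EuclideanSpace ℝ (Fin d))) (r : ℝ) :
    Set (EuclideanSpace ℝ (Fin d)) :=
  A ∩ ⋃ x ∈ frontier A, Metric.ball x r

/-- Surface measure on `∂A`: the `(d-1)`-dimensional Hausdorff measure, in its Euclidean
normalization (it agrees with Lebesgue measure on `ℝ^{d-1}`), restricted to `∂A`. -/
noncomputable def surfaceMeasure {d : ℕ} (A : Set (EuclideanSpace ℝ (Fin d))) :
    Measure (EuclideanSpace ℝ (Fin d)) :=
  (Measure.euclideanHausdorffMeasure (d - 1)).restrict (frontier A)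

/-- The perimeter `|∂A|`, the total surface measure of `∂A`. -/
noncomputable def perimeter {d : ℕ} (A : Set (EuclideanSpace ℝ (Fin d))) : ℝ :=
  (surfaceMeasure A).real univ

/-- The double integral `∫_0^r ∫_{∂A} ψ(z + s n̂_z) dz ds`, the inner one a surface integral. -/
noncomputable def normalIntegral {d : ℕ} (A : Set (EuclideanSpace ℝ (Fin d)))
    (ψ : EuclideanSpace ℝ (Fin d) → ℝ) (r : ℝ) : ℝ :=
  ∫ s in (0 : ℝ)..r, ∫ z, ψ (z + s • innerNormal A z) ∂(surfaceMeasure A)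

/-! The map `(s, z) ↦ z + s n(z)` carries `(0, r) × ∂A` bijectively onto the boundary layer minus
`∂A`, and it distorts measure by a factor `1 + O(r)` only. Both integrals are then integrals against
measures that dominate each other up to this factor.

Everything rests on two estimates for the normal on `∂A`, collected in `IsNormalField`: `n` is
Lipschitz, and `⟨n(z), w - z⟩` is quadratically small. They hold in graph charts because `f'` is
Lipschitz, and `HasC11Boundary.exists_bound` makes them uniform by compactness. Flatness gives
injectivity (`IsNormalField.injOn_normalMap`); a nearest boundary point gives surjectivity
(`HasC11Boundary.sub_eq_smul_innerNormal`).

No Jacobian is computed, as `n` is merely Lipschitz. The boundary is cut into cells of diameter at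
most `r`. On a cell, `z + s n(z)` and the flattened point `(s, Pz)`, with `P` the projection to one
tangent plane, have mutual distances agreeing up to the factor `1 + 18Lr`, so Hausdorff measures
agree up to powers of it (`IsNormalField.cell_comparison`). Summing over cells gives
`layer_comparison`. -/

open scoped MeasureTheory NNReal ENNReal

/-! ### Calculus in a graph chart -/

section Chart

variable {E F : Type*} [NormedAddCommGroup E] [InnerProductSpace ℝ E]
  [NormedAddCommGroup F] [InnerProductSpace ℝ F] [CompleteSpace F]

/-- The height of `y` above the graph of `f`, in the coordinates given by `R`. -/
noncomputable def chartHeight (R : E ≃ₗᵢ[ℝ] WithLp 2 (F × ℝ)) (f : F → ℝ) (y : E) : ℝ :=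
  (R y).snd - f (R y).fst

/-- The points over the ball `B(u₀, δ)` at height less than `η` from the graph of `f`. -/
def chartBox (R : E ≃ₗᵢ[ℝ] WithLp 2 (F × ℝ)) (f : F → ℝ) (u₀ : F) (δ η : ℝ) : Set E :=
  {y | (R y).fst ∈ Metric.ball u₀ δ ∧ |chartHeight R f y| < η}

/-- Inside `chartBox R f u₀ δ η`, the set `S` is the graph of the function `f`, whose derivative is
`K`-Lipschitz. -/
structure IsGraphChart (S : Set E) (R : E ≃ₗᵢ[ℝ] WithLp 2 (F × ℝ)) (f : F → ℝ) (u₀ : F)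
    (δ η K : ℝ) : Prop where
  eta_pos : 0 < η
  K_nonneg : 0 ≤ K
  diff : ∀ u ∈ Metric.ball u₀ δ, DifferentiableAt ℝ f u
  lip : ∀ u ∈ Metric.ball u₀ δ, ∀ v ∈ Metric.ball u₀ δ,
    ‖fderiv ℝ f u - fderiv ℝ f v‖ ≤ K * ‖u - v‖
  mem_iff : ∀ y ∈ chartBox R f u₀ δ η, y ∈ S ↔ chartHeight R f y = 0

/-- The non-normalized upper normal `(-∇f(u), 1)` of the graph of `f`, in coordinates. -/
noncomputable def graphConormal (f : F → ℝ) (u : F) : WithLp 2 (F × ℝ) :=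
  WithLp.toLp 2 (-gradient f u, (1 : ℝ))

/-- The upper unit normal of the graph of `f` over `u`. -/
noncomputable def graphNormal (R : E ≃ₗᵢ[ℝ] WithLp 2 (F × ℝ)) (f : F → ℝ) (u : F) : E :=
  R.symm (‖graphConormal f u‖⁻¹ • graphConormal f u)

omit [InnerProductSpace ℝ F] [CompleteSpace F] in
theorem WithLp.norm_fst_le_norm (x : WithLp 2 (F × ℝ)) : ‖x.fst‖ ≤ ‖x‖ := by
  have := WithLp.prod_norm_sq_eq_of_L2 x
  nlinarith [norm_nonneg x, norm_nonneg x.fst, sq_nonneg ‖x.snd‖,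
    abs_le_abs_of_nonneg (norm_nonneg x.fst) (le_refl _)]

theorem one_le_norm_graphConormal (f : F → ℝ) (u : F) : 1 ≤ ‖graphConormal f u‖ := by
  have := WithLp.prod_norm_sq_eq_of_L2 (graphConormal f u)
  have h1 : ‖(graphConormal f u).snd‖ = 1 := by simp [graphConormal]
  rw [h1] at this
  nlinarith [sq_nonneg ‖(graphConormal f u).fst‖, norm_nonneg (graphConormal f u)]

theorem inner_graphConormal (f : F → ℝ) (u : F) (x : WithLp 2 (F × ℝ)) :
    inner ℝ (graphConormal f u) x = x.snd - fderiv ℝ f u x.fst := by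
  have : inner ℝ (gradient f u) x.fst = fderiv ℝ f u x.fst := by
    simp [gradient]
  simp only [graphConormal, WithLp.prod_inner_apply, inner_neg_left]
  simp only [WithLp.ofLp_fst, WithLp.ofLp_snd, this]
  simp
  ring

theorem norm_graphNormal (R : E ≃ₗᵢ[ℝ] WithLp 2 (F × ℝ)) (f : F → ℝ) (u : F) :
    ‖graphNormal R f u‖ = 1 := by
  have := one_le_norm_graphConormal f u
  simp only [graphNormal, LinearIsometryEquiv.norm_map, norm_smul, norm_inv, norm_norm]
  exact inv_mul_cancel₀ (by linarith)

theorem inner_graphNormal (R : E ≃ₗᵢ[ℝ] WithLp 2 (F × ℝ)) (f : F → ℝ) (u : F) (y : E) :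
    inner ℝ (graphNormal R f u) y =
      ‖graphConormal f u‖⁻¹ * ((R y).snd - fderiv ℝ f u (R y).fst) := by
  rw [graphNormal, ← inner_graphConormal, ← real_inner_smul_left,
    LinearIsometryEquiv.inner_map_eq_flip]
  simp

theorem norm_graphConormal_sub (f : F → ℝ) (u v : F) :
    ‖graphConormal f u - graphConormal f v‖ = ‖fderiv ℝ f u - fderiv ℝ f v‖ := by
  have h : ‖gradient f u - gradient f v‖ = ‖fderiv ℝ f u - fderiv ℝ f v‖ := by
    simp only [gradient]
    rw [← map_sub, LinearIsometryEquiv.norm_map]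
  rw [← h, WithLp.prod_norm_eq_of_L2]
  simp [graphConormal, WithLp.sub_fst, WithLp.sub_snd]
  rw [← norm_neg]; congr 1; abel

/-- Changing the direction and changing the length each cost at most `‖a - b‖`. This passes the
Lipschitz bound for `∇f` on to the unit normal. -/
theorem norm_inv_norm_smul_sub_le {G : Type*} [NormedAddCommGroup G] [NormedSpace ℝ G] {a b : G}
    (ha : 1 ≤ ‖a‖) (hb : 1 ≤ ‖b‖) : ‖‖a‖⁻¹ • a - ‖b‖⁻¹ • b‖ ≤ 2 * ‖a - b‖ := by
  have e : ‖a‖⁻¹ • a - ‖b‖⁻¹ • b = ‖a‖⁻¹ • (a - b) + (‖a‖⁻¹ * (‖b‖ - ‖a‖)) • (‖b‖⁻¹ • b) := by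
    have h1 : ‖a‖ ≠ 0 := by linarith
    have h2 : ‖b‖ ≠ 0 := by linarith
    rw [smul_sub, smul_smul, sub_eq_add_neg, sub_eq_add_neg, add_assoc, ← neg_smul, ← neg_smul,
      ← add_smul]
    congr 2
    field_simp
    ring
  have h1 : ‖‖b‖⁻¹ • b‖ = 1 := by
    rw [norm_smul, norm_inv, norm_norm, inv_mul_cancel₀ (by linarith)]
  have h2 : ‖a‖⁻¹ ≤ 1 := inv_le_one_of_one_le₀ ha
  have h3 : |‖b‖ - ‖a‖| ≤ ‖a - b‖ := by
    rw [norm_sub_rev]; exact abs_norm_sub_norm_le b a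
  have h0 : 0 ≤ ‖a‖⁻¹ := by positivity
  rw [e]
  refine (norm_add_le _ _).trans ?_
  rw [norm_smul, norm_smul, h1, norm_inv, norm_norm, norm_mul, norm_inv, norm_norm,
    Real.norm_eq_abs]
  nlinarith [norm_nonneg (a - b), abs_nonneg (‖b‖ - ‖a‖)]

namespace IsGraphChart

variable {S : Set E} {R : E ≃ₗᵢ[ℝ] WithLp 2 (F × ℝ)} {f : F → ℝ} {u₀ : F} {δ η K : ℝ}

omit [CompleteSpace F] in
theorem continuousOn_chartHeight (h : IsGraphChart S R f u₀ δ η K) :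
    ContinuousOn (chartHeight R f) {y | (R y).fst ∈ Metric.ball u₀ δ} := by
  have hf : ContinuousOn f (Metric.ball u₀ δ) :=
    fun u hu => (h.diff u hu).continuousAt.continuousWithinAt
  have hR : Continuous fun y => (R y).fst := by fun_prop
  have hR' : Continuous fun y => (R y).snd := by fun_prop
  exact hR'.continuousOn.sub (hf.comp hR.continuousOn fun y hy => hy)

omit [CompleteSpace F] in
theorem isOpen_chartBox (h : IsGraphChart S R f u₀ δ η K) :
    IsOpen (chartBox R f u₀ δ η) := by
  have hR : Continuous fun y => (R y).fst := by fun_prop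
  exact h.continuousOn_chartHeight.abs.isOpen_inter_preimage
    (Metric.isOpen_ball.preimage hR) isOpen_Iio

omit [CompleteSpace F] in
theorem isPreconnected_side (h : IsGraphChart S R f u₀ δ η K) {J : Set ℝ} (hJ : J.OrdConnected) :
    IsPreconnected {y | (R y).fst ∈ Metric.ball u₀ δ ∧ chartHeight R f y ∈ J} := by
  have hf : ContinuousOn f (Metric.ball u₀ δ) :=
    fun u hu => (h.diff u hu).continuousAt.continuousWithinAt
  have hpre : IsPreconnected (Metric.ball u₀ δ ×ˢ J) :=
    (convex_ball u₀ δ).isPreconnected.prod hJ.isPreconnected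
  have hc : ContinuousOn (fun p : F × ℝ => R.symm (WithLp.toLp 2 (p.1, f p.1 + p.2)))
      (Metric.ball u₀ δ ×ˢ J) := by
    refine R.symm.continuous.comp_continuousOn
      ((WithLp.prod_continuous_toLp 2 F ℝ).comp_continuousOn ?_)
    exact continuousOn_fst.prodMk
      ((hf.comp continuousOn_fst fun p hp => hp.1).add continuousOn_snd)
  convert! hpre.image _ hc
  ext y
  simp only [mem_ofPred_eq, mem_image, mem_prod, Prod.exists]
  constructor
  · rintro ⟨h1, h2⟩
    refine ⟨(R y).fst, chartHeight R f y, ⟨h1, h2⟩, ?_⟩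
    rw [LinearIsometryEquiv.symm_apply_eq, chartHeight, add_sub_cancel]
    rfl
  · rintro ⟨u, t, ⟨h1, h2⟩, rfl⟩
    simpa [chartHeight] using ⟨h1, h2⟩

-- Mean value inequality on the segment, where `f'` stays within `K ‖v - u‖` of `f'(u)`.
omit [CompleteSpace F] in
theorem abs_sub_sub_fderiv_le (h : IsGraphChart S R f u₀ δ η K) {u v : F}
    (hu : u ∈ Metric.ball u₀ δ) (hv : v ∈ Metric.ball u₀ δ) :
    |f v - f u - fderiv ℝ f u (v - u)| ≤ K * ‖v - u‖ ^ 2 := by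
  have hs : segment ℝ u v ⊆ Metric.ball u₀ δ := (convex_ball u₀ δ).segment_subset hu hv
  have := (convex_segment u v).norm_image_sub_le_of_norm_hasFDerivWithin_le'
    (f := f) (f' := fderiv ℝ f) (φ := fderiv ℝ f u) (C := K * ‖v - u‖)
    (fun x hx => (h.diff x (hs hx)).hasFDerivAt.hasFDerivWithinAt)
    (fun x hx => (h.lip x (hs hx) u hu).trans
      (mul_le_mul_of_nonneg_left (norm_sub_le_of_mem_segment hx) h.K_nonneg))
    (left_mem_segment ℝ u v) (right_mem_segment ℝ u v)
  rw [Real.norm_eq_abs] at this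
  calc _ ≤ _ := this
    _ = _ := by ring

omit [CompleteSpace F] in
theorem norm_fst_sub_le (z w : E) : ‖(R z).fst - (R w).fst‖ ≤ ‖z - w‖ := by
  rw [← R.norm_map (z - w), map_sub, ← WithLp.sub_fst]
  exact WithLp.norm_fst_le_norm _

/-- Paired with the conormal `(-∇f, 1)`, a chord of the graph gives exactly the Taylor remainder of
`f`; normalizing only shrinks it, as the conormal has norm at least 1. -/
theorem abs_inner_graphNormal_le (h : IsGraphChart S R f u₀ δ η K) {z w : E}
    (hz : z ∈ S ∩ chartBox R f u₀ δ η) (hw : w ∈ S ∩ chartBox R f u₀ δ η) :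
    |inner ℝ (graphNormal R f (R z).fst) (w - z)| ≤ K * ‖w - z‖ ^ 2 := by
  have hz0 : (R z).snd = f (R z).fst := sub_eq_zero.1 ((h.mem_iff z hz.2).1 hz.1)
  have hw0 : (R w).snd = f (R w).fst := sub_eq_zero.1 ((h.mem_iff w hw.2).1 hw.1)
  rw [inner_graphNormal, map_sub, WithLp.sub_snd, WithLp.sub_fst, hz0, hw0, abs_mul]
  have h1 := h.abs_sub_sub_fderiv_le hz.2.1 hw.2.1
  have h2 := one_le_norm_graphConormal f (R z).fst
  have h3 : |‖graphConormal f (R z).fst‖⁻¹| ≤ 1 := by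
    rw [abs_of_nonneg (by positivity)]; exact inv_le_one_of_one_le₀ h2
  have h4 := norm_fst_sub_le (R := R) w z
  have h5 : ‖(R w).fst - (R z).fst‖ ^ 2 ≤ ‖w - z‖ ^ 2 := by gcongr
  calc _ ≤ 1 * (K * ‖(R w).fst - (R z).fst‖ ^ 2) := by gcongr
    _ ≤ K * ‖w - z‖ ^ 2 := by rw [one_mul]; exact mul_le_mul_of_nonneg_left h5 h.K_nonneg

theorem norm_graphNormal_sub_le (h : IsGraphChart S R f u₀ δ η K) {z w : E}
    (hz : z ∈ chartBox R f u₀ δ η) (hw : w ∈ chartBox R f u₀ δ η) :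
    ‖graphNormal R f (R z).fst - graphNormal R f (R w).fst‖ ≤ 2 * K * ‖z - w‖ := by
  rw [graphNormal, graphNormal, ← map_sub, LinearIsometryEquiv.norm_map]
  refine (norm_inv_norm_smul_sub_le (one_le_norm_graphConormal _ _)
    (one_le_norm_graphConormal _ _)).trans ?_
  rw [norm_graphConormal_sub, mul_assoc]
  gcongr
  exact (h.lip _ hz.1 _ hw.1).trans (mul_le_mul_of_nonneg_left (norm_fst_sub_le z w) h.K_nonneg)

/-- The tangent vector of the graph of `f` over `u` in direction `k`. -/
noncomputable def _root_.graphTangent (R : E ≃ₗᵢ[ℝ] WithLp 2 (F × ℝ)) (f : F → ℝ) (u : F) :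
    F →L[ℝ] E :=
  (R.symm.toContinuousLinearEquiv : WithLp 2 (F × ℝ) →L[ℝ] E).comp
    (((WithLp.prodContinuousLinearEquiv 2 ℝ F ℝ).symm : F × ℝ →L[ℝ] WithLp 2 (F × ℝ)).comp
      ((ContinuousLinearMap.id ℝ F).prod (fderiv ℝ f u)))

omit [CompleteSpace F] in
theorem _root_.graphTangent_apply (R : E ≃ₗᵢ[ℝ] WithLp 2 (F × ℝ)) (f : F → ℝ) (u k : F) :
    graphTangent R f u k = R.symm (WithLp.toLp 2 (k, fderiv ℝ f u k)) := rfl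

omit [CompleteSpace F] in
theorem hasFDerivAt_graph (h : IsGraphChart S R f u₀ δ η K) {u : F}
    (hu : u ∈ Metric.ball u₀ δ) :
    HasFDerivAt (fun v => R.symm (WithLp.toLp 2 (v, f v))) (graphTangent R f u) u := by
  have h1 : HasFDerivAt (fun v => (v, f v))
      ((ContinuousLinearMap.id ℝ F).prod (fderiv ℝ f u)) u :=
    (hasFDerivAt_id u).prodMk (h.diff u hu).hasFDerivAt
  have h2 := (WithLp.prodContinuousLinearEquiv 2 ℝ F ℝ).symm.hasFDerivAt (x := (u, f u))
  have h3 := R.symm.toContinuousLinearEquiv.hasFDerivAt (x := WithLp.toLp 2 (u, f u))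
  exact HasFDerivAt.comp u h3 (HasFDerivAt.comp u h2 h1)

omit [CompleteSpace F] in
theorem graph_mem (h : IsGraphChart S R f u₀ δ η K) {u : F}
    (hu : u ∈ Metric.ball u₀ δ) :
    R.symm (WithLp.toLp 2 (u, f u)) ∈ S ∩ chartBox R f u₀ δ η := by
  have h1 : R.symm (WithLp.toLp 2 (u, f u)) ∈ chartBox R f u₀ δ η := by
    simpa [chartBox, chartHeight] using ⟨hu, h.eta_pos⟩
  exact ⟨(h.mem_iff _ h1).2 (by simp [chartHeight]), h1⟩

omit [CompleteSpace F] in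
theorem graph_fst (h : IsGraphChart S R f u₀ δ η K) {z : E}
    (hz : z ∈ S ∩ chartBox R f u₀ δ η) :
    R.symm (WithLp.toLp 2 ((R z).fst, f (R z).fst)) = z := by
  have hz0 : (R z).snd = f (R z).fst := sub_eq_zero.1 ((h.mem_iff z hz.2).1 hz.1)
  rw [LinearIsometryEquiv.symm_apply_eq, ← hz0]
  rfl

omit [CompleteSpace F] in
theorem graphTangent_mem_tangentConeAt (h : IsGraphChart S R f u₀ δ η K) {z : E}
    (hz : z ∈ S ∩ chartBox R f u₀ δ η) (k : F) :
    graphTangent R f (R z).fst k ∈ tangentConeAt ℝ S z := by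
  have h1 := (h.hasFDerivAt_graph hz.2.1).hasFDerivWithinAt (s := Metric.ball u₀ δ)
    |>.mapsTo_tangent_cone
  rw [tangentConeAt_of_mem_nhds (Metric.isOpen_ball.mem_nhds hz.2.1), h.graph_fst hz] at h1
  refine tangentConeAt_mono ?_ (h1 (mem_univ k))
  rintro _ ⟨u, hu, rfl⟩
  exact (h.graph_mem hu).1

/-- By quadratic flatness, `⟨N, ·⟩` has derivative zero along `S` at `z`. It is also its own
derivative, and two derivatives within `S` agree on the tangent cone. -/
theorem inner_graphNormal_eq_zero (h : IsGraphChart S R f u₀ δ η K) {z : E}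
    (hz : z ∈ S ∩ chartBox R f u₀ δ η) {w : E} (hw : w ∈ tangentConeAt ℝ S z) :
    inner ℝ (graphNormal R f (R z).fst) w = 0 := by
  set N := graphNormal R f (R z).fst
  have h1 : HasFDerivWithinAt (fun y => inner ℝ N y) (innerSL ℝ N) S z :=
    (innerSL ℝ N).hasFDerivWithinAt
  have h2 : HasFDerivWithinAt (fun y => inner ℝ N y) (0 : E →L[ℝ] ℝ) S z := by
    rw [hasFDerivWithinAt_iff_isLittleO]
    simp only [← inner_sub_right]
    have hO : (fun y => inner ℝ N (y - z) - (0 : E →L[ℝ] ℝ) (y - z)) =O[𝓝[S] z]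
        fun y => ‖y - z‖ ^ 2 := by
      refine Asymptotics.IsBigO.of_bound K ?_
      filter_upwards [self_mem_nhdsWithin,
        mem_nhdsWithin_of_mem_nhds (h.isOpen_chartBox.mem_nhds hz.2)] with y hy hy'
      simpa using h.abs_inner_graphNormal_le hz ⟨hy, hy'⟩
    refine hO.trans_isLittleO ?_
    have ht : Tendsto (fun y => ‖y - z‖) (𝓝[S] z) (𝓝 0) := by
      have : Continuous fun y => ‖y - z‖ := by fun_prop
      simpa using (this.tendsto z).mono_left nhdsWithin_le_nhds
    have := (Asymptotics.isLittleO_one_iff ℝ).2 ht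
    have h3 := this.mul_isBigO (Asymptotics.isBigO_refl (fun y => ‖y - z‖) (𝓝[S] z))
    simp only [one_mul, ← sq] at h3
    exact h3.of_norm_right
  have := h1.unique_on h2 hw
  simpa using this

/-- A unit vector that is orthogonal to the graph is `±` its unit normal. -/
theorem eq_graphNormal_or_eq_neg {u : F} {v : E} (hv : ‖v‖ = 1)
    (ht : ∀ k, inner ℝ v (graphTangent R f u k) = 0) :
    v = graphNormal R f u ∨ v = -graphNormal R f u := by
  have h1 : ∀ k : F, inner ℝ (R v).fst k + (R v).snd * fderiv ℝ f u k = 0 := by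
    intro k
    have := ht k
    rw [graphTangent_apply, real_inner_comm, LinearIsometryEquiv.inner_map_eq_flip,
      real_inner_comm, LinearIsometryEquiv.symm_symm, WithLp.prod_inner_apply] at this
    rw [← this]
    simp [mul_comm]
  have h2 : (R v).fst = -((R v).snd • gradient f u) := by
    rw [← sub_eq_zero, ← inner_self_eq_zero (𝕜 := ℝ)]
    have e : fderiv ℝ f u = InnerProductSpace.toDual ℝ F (gradient f u) := by simp [gradient]
    -- Orthogonality is tested on the very vector that is to vanish.
    have := h1 ((R v).fst - -((R v).snd • gradient f u))
    rw [e, InnerProductSpace.toDual_apply_apply] at this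
    rw [inner_sub_left, inner_neg_left, real_inner_smul_left]
    linarith
  have h3 : R v = (R v).snd • graphConormal f u := by
    apply WithLp.ofLp_injective
    ext1
    · simpa [graphConormal] using h2
    · simp [graphConormal]
  have h4 := one_le_norm_graphConormal f u
  have h5 : |(R v).snd| * ‖graphConormal f u‖ = 1 := by
    rw [← Real.norm_eq_abs, ← norm_smul, ← h3, R.norm_map, hv]
  have h6 : v = (R v).snd • R.symm (graphConormal f u) := by
    rw [← map_smul, ← h3]; simp
  have h7 : |(R v).snd| = ‖graphConormal f u‖⁻¹ := eq_inv_of_mul_eq_one_left h5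
  rcases abs_choice (R v).snd with h8 | h8
  · left
    rw [graphNormal, ← h7, h8, map_smul]
    exact h6
  · right
    rw [graphNormal, ← h7, h8, map_smul, neg_smul, neg_neg]
    exact h6

/-- Along `N` the height grows at rate `‖graphConormal‖ > 0`. The sign of the inner side gives
existence of the inner normal, the opposite sign its uniqueness. -/
theorem eventually_chartHeight (h : IsGraphChart S R f u₀ δ η K) {z : E}
    (hz : z ∈ S ∩ chartBox R f u₀ δ η) {σ : ℝ} (hσ : σ = 1 ∨ σ = -1) :
    ∀ᶠ s : ℝ in 𝓝[>] 0, z + s • (σ • graphNormal R f (R z).fst) ∈ chartBox R f u₀ δ η ∧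
      0 < σ * chartHeight R f (z + s • (σ • graphNormal R f (R z).fst)) := by
  set N := graphNormal R f (R z).fst with hN
  have hz0 : chartHeight R f z = 0 := (h.mem_iff z hz.2).1 hz.1
  have hc : Continuous fun s : ℝ => z + s • (σ • N) := by fun_prop
  have e1 : ∀ᶠ s : ℝ in 𝓝[>] 0, z + s • (σ • N) ∈ chartBox R f u₀ δ η := by
    have := (hc.tendsto 0).eventually_mem
      (by simpa using h.isOpen_chartBox.mem_nhds hz.2 : chartBox R f u₀ δ η ∈ _)
    exact this.filter_mono nhdsWithin_le_nhds
  have hl : HasDerivAt (fun s : ℝ => z + s • (σ • N)) (σ • N) 0 := by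
    simpa using ((hasDerivAt_id (0 : ℝ)).smul_const (σ • N)).const_add z
  have hfst : HasDerivAt (fun s : ℝ => (R (z + s • (σ • N))).fst) (R (σ • N)).fst 0 :=
    ((WithLp.fstL 2 ℝ F ℝ).comp
      (R.toContinuousLinearEquiv : E →L[ℝ] WithLp 2 (F × ℝ))).hasFDerivAt.comp_hasDerivAt 0 hl
  have hsnd : HasDerivAt (fun s : ℝ => (R (z + s • (σ • N))).snd) (R (σ • N)).snd 0 :=
    ((WithLp.sndL 2 ℝ F ℝ).comp
      (R.toContinuousLinearEquiv : E →L[ℝ] WithLp 2 (F × ℝ))).hasFDerivAt.comp_hasDerivAt 0 hl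
  have hf0 : HasFDerivAt f (fderiv ℝ f (R z).fst) (R (z + (0 : ℝ) • (σ • N))).fst := by
    simpa using (h.diff _ hz.2.1).hasFDerivAt
  have hd : HasDerivAt (fun s : ℝ => chartHeight R f (z + s • (σ • N)))
      ((R (σ • N)).snd - fderiv ℝ f (R z).fst (R (σ • N)).fst) 0 :=
    hsnd.sub (hf0.comp_hasDerivAt (0 : ℝ) hfst)
  have hcp : 0 < ‖graphConormal f (R z).fst‖ :=
    lt_of_lt_of_le one_pos (one_le_norm_graphConormal f (R z).fst)
  have hval : (R (σ • N)).snd - fderiv ℝ f (R z).fst (R (σ • N)).fst =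
      σ * ‖graphConormal f (R z).fst‖ := by
    have h1 := inner_graphNormal R f (R z).fst (σ • N)
    rw [← hN, real_inner_smul_right, real_inner_self_eq_norm_sq, norm_graphNormal] at h1
    field_simp at h1
    linarith
  rw [hval, hasDerivAt_iff_tendsto_slope] at hd
  have h2 := hd.const_mul σ
  have hσ2 : σ * σ = 1 := by rcases hσ with rfl | rfl <;> norm_num
  rw [← mul_assoc, hσ2, one_mul] at h2
  have h3 := (h2.eventually (lt_mem_nhds hcp)).filter_mono
    (nhdsWithin_mono (0 : ℝ) (fun s (hs : s ∈ Ioi 0) => ne_of_gt hs))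
  filter_upwards [e1, h3, self_mem_nhdsWithin] with s hs1 hs2 hs3
  refine ⟨hs1, ?_⟩
  have hs3 : 0 < s := hs3
  simp only [slope, zero_smul, add_zero, hz0, vsub_eq_sub, sub_zero, smul_eq_mul] at hs2
  have : 0 < s * (σ * (s⁻¹ * chartHeight R f (z + s • (σ • N)))) := mul_pos hs3 hs2
  field_simp at this
  linarith

end IsGraphChart
end Chart

/-- Interior and exterior are disjoint open sets covering the complement of the frontier. Applied to
a side of a graph, to a ball around a layer point and to a normal segment. -/
theorem IsPreconnected.subset_interior_or_subset_compl_closure {X : Type*} [TopologicalSpace X]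
    {s A : Set X} (hs : IsPreconnected s) (h : Disjoint s (frontier A)) :
    s ⊆ interior A ∨ s ⊆ (closure A)ᶜ := by
  refine hs.subset_or_subset isOpen_interior isClosed_closure.isOpen_compl ?_ ?_
  · exact disjoint_compl_right.mono_left (interior_subset.trans subset_closure)
  · intro x hx
    by_cases h1 : x ∈ closure A
    · refine Or.inl (by_contra fun h2 => ?_)
      exact h.ne_of_mem hx (⟨h1, h2⟩ : x ∈ frontier A) rfl
    · exact Or.inr h1

/-! ### The inner side of a chart and the inner normal -/

section Chart

variable {F : Type*} [NormedAddCommGroup F] [InnerProductSpace ℝ F] [CompleteSpace F]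
  {d : ℕ} {A : Set (EuclideanSpace ℝ (Fin d))} {R : EuclideanSpace ℝ (Fin d) ≃ₗᵢ[ℝ] WithLp 2 (F × ℝ)}
  {f : F → ℝ} {u₀ : F} {δ η K : ℝ}

namespace IsGraphChart

omit [CompleteSpace F] in
/-- A regular closed set whose boundary is a graph lies on exactly one side of it. -/
theorem exists_side (h : IsGraphChart (frontier A) R f u₀ δ η K) (hreg : A = closure (interior A))
    {x : EuclideanSpace ℝ (Fin d)} (hx : x ∈ frontier A ∩ chartBox R f u₀ δ η) :
    ∃ σ : ℝ, (σ = 1 ∨ σ = -1) ∧ (∀ y ∈ chartBox R f u₀ δ η, 0 < σ * chartHeight R f y → y ∈ A) ∧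
      ∀ y ∈ chartBox R f u₀ δ η, σ * chartHeight R f y < 0 → y ∉ A := by
  have hcl : IsClosed A := hreg ▸ isClosed_closure
  have key : ∀ J : Set ℝ, J.OrdConnected → J ⊆ Ioo (-η) η → (0 : ℝ) ∉ J →
      {y | (R y).fst ∈ Metric.ball u₀ δ ∧ chartHeight R f y ∈ J} ⊆ interior A ∨
      {y | (R y).fst ∈ Metric.ball u₀ δ ∧ chartHeight R f y ∈ J} ⊆ Aᶜ := by
    intro J hJ hJη hJ0
    have := (h.isPreconnected_side hJ).subset_interior_or_subset_compl_closure (A := A) ?_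
    · rwa [hcl.closure_eq] at this
    · rw [Set.disjoint_left]
      rintro y ⟨hy1, hy2⟩ hy3
      have h0 := (h.mem_iff y ⟨hy1, abs_lt.2 (hJη hy2)⟩).1 hy3
      exact hJ0 (h0 ▸ hy2)
  have hη := h.eta_pos
  have cases3 : ∀ y ∈ chartBox R f u₀ δ η, (y ∈ frontier A) ∨
      (y ∈ {y | (R y).fst ∈ Metric.ball u₀ δ ∧ chartHeight R f y ∈ Ioo 0 η}) ∨
      (y ∈ {y | (R y).fst ∈ Metric.ball u₀ δ ∧ chartHeight R f y ∈ Ioo (-η) 0}) := by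
    rintro y ⟨hy1, hy2⟩
    rw [abs_lt] at hy2
    rcases lt_trichotomy (chartHeight R f y) 0 with h0 | h0 | h0
    · exact Or.inr (Or.inr ⟨hy1, hy2.1, h0⟩)
    · exact Or.inl ((h.mem_iff y ⟨hy1, abs_lt.2 hy2⟩).2 h0)
    · exact Or.inr (Or.inl ⟨hy1, h0, hy2.2⟩)
  have hp := key (Ioo 0 η) ordConnected_Ioo (Ioo_subset_Ioo_left (by linarith)) (by simp)
  have hm := key (Ioo (-η) 0) ordConnected_Ioo (Ioo_subset_Ioo_right (by linarith)) (by simp)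
  have hbox := h.isOpen_chartBox.mem_nhds hx.2
  have hfr : frontier A ⊆ A := hcl.frontier_subset
  rcases hp with hp | hp <;> rcases hm with hm | hm
  -- With both sides inside, `x` would be an interior point.
  · exfalso
    have : chartBox R f u₀ δ η ⊆ A := by
      intro y hy
      rcases cases3 y hy with h1 | h1 | h1
      exacts [hfr h1, interior_subset (hp h1), interior_subset (hm h1)]
    exact hx.1.2 (mem_interior_iff_mem_nhds.2 (mem_of_superset hbox this))
  · refine ⟨1, Or.inl rfl, fun y hy h0 => ?_, fun y hy h0 => ?_⟩
    · exact interior_subset (hp ⟨hy.1, by linarith, (abs_lt.1 hy.2).2⟩)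
    · exact hm ⟨hy.1, (abs_lt.1 hy.2).1, by linarith⟩
  · refine ⟨-1, Or.inr rfl, fun y hy h0 => ?_, fun y hy h0 => ?_⟩
    · exact interior_subset (hm ⟨hy.1, (abs_lt.1 hy.2).1, by linarith⟩)
    · exact hp ⟨hy.1, by linarith, (abs_lt.1 hy.2).2⟩
  -- With both sides outside, `x` could not be a limit of interior points, as regularity of `A`
  -- demands.
  · exfalso
    have hxA : x ∈ closure (interior A) := hreg ▸ hfr hx.1
    obtain ⟨y, hy1, hy2⟩ := mem_closure_iff_nhds.1 hxA _ hbox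
    rcases cases3 y hy1 with h1 | h1 | h1
    exacts [h1.2 hy2, hp h1 (interior_subset hy2), hm h1 (interior_subset hy2)]

section Side

variable {σ : ℝ}

theorem isInnerUnitNormal_graphNormal (h : IsGraphChart (frontier A) R f u₀ δ η K)
    (hσ : σ = 1 ∨ σ = -1)
    (hA : ∀ y ∈ chartBox R f u₀ δ η, 0 < σ * chartHeight R f y → y ∈ A)
    {z : EuclideanSpace ℝ (Fin d)} (hz : z ∈ frontier A ∩ chartBox R f u₀ δ η) :
    IsInnerUnitNormal A z (σ • graphNormal R f (R z).fst) := by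
  refine ⟨?_, fun w hw => ?_, ?_⟩
  · rw [norm_smul, norm_graphNormal]
    rcases hσ with rfl | rfl <;> simp
  · rw [real_inner_smul_left, h.inner_graphNormal_eq_zero hz hw, mul_zero]
  · filter_upwards [h.eventually_chartHeight hz hσ] with s hs
    exact hA _ hs.1 hs.2

/-- The opposite normal would leave `A` at once. Only tangents of the graph are tested, not the
whole tangent cone, so the lemma also serves for nearest-point directions. -/
theorem eq_smul_graphNormal (h : IsGraphChart (frontier A) R f u₀ δ η K)
    (hσ : σ = 1 ∨ σ = -1)
    (hAc : ∀ y ∈ chartBox R f u₀ δ η, σ * chartHeight R f y < 0 → y ∉ A)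
    {z : EuclideanSpace ℝ (Fin d)} (hz : z ∈ frontier A ∩ chartBox R f u₀ δ η)
    {v : EuclideanSpace ℝ (Fin d)} (hv : ‖v‖ = 1)
    (ht : ∀ k, inner ℝ v (graphTangent R f (R z).fst k) = 0)
    (hin : ∀ᶠ s : ℝ in 𝓝[>] 0, z + s • v ∈ A) :
    v = σ • graphNormal R f (R z).fst := by
  by_contra hne
  have hv' : v = (-σ) • graphNormal R f (R z).fst := by
    rcases eq_graphNormal_or_eq_neg hv ht with h1 | h1 <;> rcases hσ with rfl | rfl <;>
      simp_all
  have hσ' : -σ = 1 ∨ -σ = -1 := by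
    rcases hσ with rfl | rfl <;> simp
  have h2 := h.eventually_chartHeight hz hσ'
  rw [← hv'] at h2
  obtain ⟨s, hs1, hs2, hs3⟩ := (hin.and h2).exists
  exact hAc _ hs2 (by linarith) hs1

theorem innerNormal_eq (h : IsGraphChart (frontier A) R f u₀ δ η K)
    (hσ : σ = 1 ∨ σ = -1)
    (hA : ∀ y ∈ chartBox R f u₀ δ η, 0 < σ * chartHeight R f y → y ∈ A)
    (hAc : ∀ y ∈ chartBox R f u₀ δ η, σ * chartHeight R f y < 0 → y ∉ A)
    {z : EuclideanSpace ℝ (Fin d)} (hz : z ∈ frontier A ∩ chartBox R f u₀ δ η) :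
    innerNormal A z = σ • graphNormal R f (R z).fst := by
  have hs : IsInnerUnitNormal A z (innerNormal A z) :=
    Classical.epsilon_spec (p := fun v => IsInnerUnitNormal A z v)
      ⟨_, h.isInnerUnitNormal_graphNormal hσ hA hz⟩
  exact h.eq_smul_graphNormal hσ hAc hz hs.1
    (fun k => hs.2.1 _ (h.graphTangent_mem_tangentConeAt hz k)) hs.2.2

end Side

omit [CompleteSpace F] in
/-- The vector from a nearest point of `S` is orthogonal to `S`. -/
theorem inner_graphTangent_eq_zero_of_nearest {E : Type*} [NormedAddCommGroup E]
    [InnerProductSpace ℝ E] {S : Set E} {R : E ≃ₗᵢ[ℝ] WithLp 2 (F × ℝ)}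
    (h : IsGraphChart S R f u₀ δ η K) {z y : E}
    (hz : z ∈ S ∩ chartBox R f u₀ δ η) (hy : ∀ p ∈ S, dist y z ≤ dist y p) (k : F) :
    inner ℝ (y - z) (graphTangent R f (R z).fst k) = 0 := by
  have h1 := ((h.hasFDerivAt_graph hz.2.1).sub_const y).norm_sq
  have hmin : IsLocalMin (fun u => ‖R.symm (WithLp.toLp 2 (u, f u)) - y‖ ^ 2) (R z).fst := by
    filter_upwards [Metric.isOpen_ball.mem_nhds hz.2.1] with u hu
    rw [h.graph_fst hz]
    have := hy _ (h.graph_mem hu).1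
    rw [dist_comm, dist_eq_norm, dist_comm, dist_eq_norm] at this
    gcongr
  have h2 := hmin.hasFDerivAt_eq_zero h1
  have h3 := congrArg (fun L => L k) h2
  rw [h.graph_fst hz] at h3
  simp at h3
  rw [inner_sub_left]
  linarith

end IsGraphChart

/-- The box must fit into `U`: over a small ball, continuity of `f` keeps horizontal offsets below
`ε / 2` and vertical ones below `ε / 4 + ε / 4`. -/
theorem HasC11Boundary.exists_isGraphChart (hC11 : HasC11Boundary A)
    {x : EuclideanSpace ℝ (Fin d)} (hx : x ∈ frontier A) :
    ∃ (R : EuclideanSpace ℝ (Fin d) ≃ₗᵢ[ℝ] WithLp 2 (EuclideanSpace ℝ (Fin (d - 1)) × ℝ))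
      (f : EuclideanSpace ℝ (Fin (d - 1)) → ℝ) (u₀ : EuclideanSpace ℝ (Fin (d - 1)))
      (δ η K : ℝ), IsGraphChart (frontier A) R f u₀ δ η K ∧ x ∈ chartBox R f u₀ δ η := by
  obtain ⟨U, hU, R, V, hV, f, hf, ⟨K, hK⟩, hUV⟩ := hC11 x hx
  have hxU : x ∈ frontier A ∩ U := ⟨hx, mem_of_mem_nhds hU⟩
  rw [hUV] at hxU
  obtain ⟨hxV, hxf⟩ := hxU
  obtain ⟨ε, hε, hεU⟩ := Metric.mem_nhds_iff.1 hU
  set u₀ := (R x).fst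
  have hfc : ContinuousAt f u₀ := (hf.differentiableAt (hV.mem_nhds hxV)).continuousAt
  have h1 : ∀ᶠ u in 𝓝 u₀, u ∈ V ∧ dist (f u) (f u₀) < ε / 4 ∧ u ∈ Metric.ball u₀ (ε / 2) :=
    Filter.Eventually.and (hV.mem_nhds hxV) ((Metric.tendsto_nhds.1 hfc (ε / 4) (by positivity)).and
      (Metric.ball_mem_nhds u₀ (by positivity)))
  obtain ⟨δ, hδ, hδV⟩ := Metric.mem_nhds_iff.1 h1
  refine ⟨R, f, u₀, δ, ε / 4, K, ⟨by positivity, K.2, ?_, ?_, ?_⟩, ?_⟩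
  · exact fun u hu => hf.differentiableAt (hV.mem_nhds (hδV hu).1)
  · intro u hu v hv
    have := hK.dist_le_mul u (hδV hu).1 v (hδV hv).1
    rwa [dist_eq_norm, dist_eq_norm] at this
  · rintro y ⟨hy1, hy2⟩
    have h2 := hδV hy1
    have hyU : y ∈ U := by
      apply hεU
      rw [Metric.mem_ball, dist_eq_norm, ← R.norm_map, map_sub]
      have h3 : ‖(R y - R x).fst‖ < ε / 2 := by
        have := h2.2.2
        rwa [Metric.mem_ball, dist_eq_norm] at this
      have h4 : |(R y - R x).snd| < ε / 2 := by
        rw [WithLp.sub_snd, hxf]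
        have h5 := h2.2.1
        rw [Real.dist_eq] at h5
        have e : (R y).snd - f u₀ = chartHeight R f y + (f (R y).fst - f u₀) := by
          rw [chartHeight]; ring
        rw [e]
        exact (abs_add_le _ _).trans_lt (by linarith)
      have h5 := WithLp.prod_norm_sq_eq_of_L2 (R y - R x)
      rw [Real.norm_eq_abs] at h5
      refine lt_of_pow_lt_pow_left₀ 2 hε.le ?_
      rw [h5]
      have h6 := norm_nonneg (R y - R x).fst
      have h7 := abs_nonneg (R y - R x).snd
      nlinarith
    have h3 : y ∈ frontier A ↔ y ∈ frontier A ∩ U := by simp [hyU]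
    rw [h3, hUV, chartHeight, sub_eq_zero]
    exact ⟨fun h => h.2, fun h => ⟨h2.1, h⟩⟩
  · refine ⟨Metric.mem_ball_self hδ, ?_⟩
    rw [chartHeight, hxf, sub_self, abs_zero]
    positivity

end Chart

/-! ### Uniform bounds for the normal, and nearest points -/

section Global

variable {d : ℕ} {A : Set (EuclideanSpace ℝ (Fin d))}

theorem HasC11Boundary.isInnerUnitNormal_innerNormal (hC11 : HasC11Boundary A)
    (hreg : A = closure (interior A)) {z : EuclideanSpace ℝ (Fin d)} (hz : z ∈ frontier A) :
    IsInnerUnitNormal A z (innerNormal A z) := by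
  obtain ⟨R, f, u₀, δ, η, K, h, hx⟩ := hC11.exists_isGraphChart hz
  obtain ⟨σ, hσ, hA, hAc⟩ := h.exists_side hreg ⟨hz, hx⟩
  rw [h.innerNormal_eq hσ hA hAc ⟨hz, hx⟩]
  exact h.isInnerUnitNormal_graphNormal hσ hA ⟨hz, hx⟩

theorem HasC11Boundary.exists_local_bound (hC11 : HasC11Boundary A)
    (hreg : A = closure (interior A)) {x : EuclideanSpace ℝ (Fin d)} (hx : x ∈ frontier A) :
    ∃ W ∈ 𝓝 x, ∃ L : ℝ, ∀ z ∈ frontier A ∩ W, ∀ w ∈ frontier A ∩ W,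
      ‖innerNormal A z - innerNormal A w‖ ≤ L * ‖z - w‖ ∧
      |inner ℝ (innerNormal A z) (w - z)| ≤ L * ‖w - z‖ ^ 2 := by
  obtain ⟨R, f, u₀, δ, η, K, h, hxb⟩ := hC11.exists_isGraphChart hx
  obtain ⟨σ, hσ, hA, hAc⟩ := h.exists_side hreg ⟨hx, hxb⟩
  refine ⟨_, h.isOpen_chartBox.mem_nhds hxb, 2 * K, fun z hz w hw => ?_⟩
  have hσ1 : |σ| = 1 := by rcases hσ with rfl | rfl <;> simp
  rw [h.innerNormal_eq hσ hA hAc hz, h.innerNormal_eq hσ hA hAc hw, ← smul_sub, norm_smul,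
    Real.norm_eq_abs, hσ1, one_mul, real_inner_smul_left, abs_mul, hσ1, one_mul]
  refine ⟨h.norm_graphNormal_sub_le hz.2 hw.2, (h.abs_inner_graphNormal_le hz hw).trans ?_⟩
  have := h.K_nonneg
  gcongr
  linarith

/-- The unit normal of a compact `C^{1,1}` boundary is Lipschitz, and the boundary deviates from its
tangent planes at most quadratically. -/
theorem HasC11Boundary.exists_bound (hC11 : HasC11Boundary A)
    (hreg : A = closure (interior A)) (hbdd : Bornology.IsBounded A) :
    ∃ L : ℝ, 0 < L ∧ ∀ z ∈ frontier A, ∀ w ∈ frontier A,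
      ‖innerNormal A z - innerNormal A w‖ ≤ L * ‖z - w‖ ∧
      |inner ℝ (innerNormal A z) (w - z)| ≤ L * ‖w - z‖ ^ 2 := by
  have hcl : IsClosed A := hreg ▸ isClosed_closure
  have hcpt : IsCompact (frontier A) :=
    (Metric.isCompact_of_isClosed_isBounded hcl hbdd).of_isClosed_subset isClosed_frontier
      hcl.frontier_subset
  have key : ∃ L : ℝ, ∀ p ∈ frontier A ×ˢ frontier A, p ∈ frontier A ×ˢ frontier A →
      ‖innerNormal A p.1 - innerNormal A p.2‖ ≤ L * ‖p.1 - p.2‖ ∧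
      |inner ℝ (innerNormal A p.1) (p.2 - p.1)| ≤ L * ‖p.2 - p.1‖ ^ 2 := by
    -- The estimates concern pairs, so compactness of `∂A × ∂A` is used: charts serve near the
    -- diagonal, while elsewhere `‖z - w‖` is bounded below and unit length of the normals suffices.
    refine (hcpt.prod hcpt).induction_on
      (p := fun s => ∃ L : ℝ, ∀ p ∈ s, p ∈ frontier A ×ˢ frontier A →
        ‖innerNormal A p.1 - innerNormal A p.2‖ ≤ L * ‖p.1 - p.2‖ ∧
        |inner ℝ (innerNormal A p.1) (p.2 - p.1)| ≤ L * ‖p.2 - p.1‖ ^ 2) ?_ ?_ ?_ ?_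
    · exact ⟨0, by simp⟩
    · rintro s t hst ⟨L, hL⟩
      exact ⟨L, fun p hp => hL p (hst hp)⟩
    · rintro s t ⟨L, hL⟩ ⟨L', hL'⟩
      refine ⟨max L L', fun p hp hpA => ?_⟩
      rcases hp with hp | hp
      · obtain ⟨h1, h2⟩ := hL p hp hpA
        exact ⟨h1.trans (by gcongr; exact le_max_left _ _),
          h2.trans (by gcongr; exact le_max_left _ _)⟩
      · obtain ⟨h1, h2⟩ := hL' p hp hpA
        exact ⟨h1.trans (by gcongr; exact le_max_right _ _),
          h2.trans (by gcongr; exact le_max_right _ _)⟩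
    · rintro ⟨x, y⟩ ⟨hx, hy⟩
      by_cases hxy : x = y
      · subst hxy
        obtain ⟨W, hW, L, hL⟩ := hC11.exists_local_bound hreg hx
        exact ⟨W ×ˢ W, mem_nhdsWithin_of_mem_nhds (prod_mem_nhds hW hW), L,
          fun p hp hpA => hL p.1 ⟨hpA.1, hp.1⟩ p.2 ⟨hpA.2, hp.2⟩⟩
      · have hd : 0 < dist x y := dist_pos.2 hxy
        set ε := dist x y / 2
        have hε : 0 < ε := by positivity
        have hc : Continuous fun p : EuclideanSpace ℝ (Fin d) × EuclideanSpace ℝ (Fin d) =>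
            dist p.1 p.2 := by fun_prop
        have hev : ∀ᶠ p in 𝓝 (x, y), ε < dist p.1 p.2 :=
          (hc.tendsto (x, y)).eventually (lt_mem_nhds (half_lt_self hd))
        refine ⟨_, mem_nhdsWithin_of_mem_nhds hev, 2 / ε, ?_⟩
        rintro ⟨z, w⟩ hzw ⟨hz, hw⟩
        have hzw : ε < ‖z - w‖ := by rw [← dist_eq_norm]; exact hzw
        have hnz := (hC11.isInnerUnitNormal_innerNormal hreg hz).1
        have hnw := (hC11.isInnerUnitNormal_innerNormal hreg hw).1
        constructor
        · refine (norm_sub_le _ _).trans ?_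
          dsimp only
          rw [hnz, hnw, div_mul_eq_mul_div, le_div_iff₀ hε]
          linarith
        · refine (abs_real_inner_le_norm _ _).trans ?_
          dsimp only
          rw [hnz, norm_sub_rev, div_mul_eq_mul_div, le_div_iff₀ hε]
          nlinarith
  obtain ⟨L, hL⟩ := key
  refine ⟨max L 1, by positivity, fun z hz w hw => ?_⟩
  obtain ⟨h1, h2⟩ := hL (z, w) ⟨hz, hw⟩ ⟨hz, hw⟩
  exact ⟨h1.trans (by gcongr; exact le_max_left _ _),
    h2.trans (by gcongr; exact le_max_left _ _)⟩

/-- The first-order condition at a nearest point makes `y - z` normal. The open ball around `y`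
reaching to `z` misses `∂A`, hence lies in the interior, so `y - z` points inwards. -/
theorem HasC11Boundary.sub_eq_smul_innerNormal (hC11 : HasC11Boundary A)
    (hreg : A = closure (interior A)) {y z : EuclideanSpace ℝ (Fin d)} (hy : y ∈ interior A)
    (hz : z ∈ frontier A) (hyz : ∀ p ∈ frontier A, dist y z ≤ dist y p) :
    y = z + dist y z • innerNormal A z := by
  obtain ⟨R, f, u₀, δ, η, K, h, hx⟩ := hC11.exists_isGraphChart hz
  obtain ⟨σ, hσ, hA, hAc⟩ := h.exists_side hreg ⟨hz, hx⟩
  rw [h.innerNormal_eq hσ hA hAc ⟨hz, hx⟩]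
  have hne : y ≠ z := fun e => hz.2 (e ▸ hy)
  have hpos : 0 < dist y z := dist_pos.2 hne
  have hball : Metric.ball y (dist y z) ⊆ interior A := by
    refine ((convex_ball y _).isPreconnected.subset_interior_or_subset_compl_closure
      (A := A) ?_).resolve_right ?_
    · rw [Set.disjoint_left]
      intro p hp hpA
      have := hyz p hpA
      rw [Metric.mem_ball, dist_comm] at hp
      linarith
    · intro hsub
      exact hsub (Metric.mem_ball_self hpos) (subset_closure (interior_subset hy))
  have hv := h.eq_smul_graphNormal hσ hAc ⟨hz, hx⟩ (v := (dist y z)⁻¹ • (y - z)) ?_ ?_ ?_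
  · rw [← hv, smul_smul, mul_inv_cancel₀ hpos.ne', one_smul, add_sub_cancel]
  · rw [norm_smul, dist_eq_norm, norm_inv, norm_norm, inv_mul_cancel₀]
    rw [← dist_eq_norm]; exact hpos.ne'
  · intro k
    rw [real_inner_smul_left, h.inner_graphTangent_eq_zero_of_nearest ⟨hz, hx⟩ hyz k, mul_zero]
  · filter_upwards [Ioo_mem_nhdsGT hpos] with s hs
    apply interior_subset
    apply hball
    have e : z + s • (dist y z)⁻¹ • (y - z) - y = -((1 - s * (dist y z)⁻¹) • (y - z)) := by
      module
    have h1 : s * (dist y z)⁻¹ < 1 := by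
      rw [← div_eq_mul_inv, div_lt_one hpos]; exact hs.2
    have h2 : 0 < s * (dist y z)⁻¹ := mul_pos hs.1 (inv_pos.2 hpos)
    rw [Metric.mem_ball, dist_eq_norm, e, norm_neg, norm_smul, Real.norm_eq_abs,
      abs_of_pos (by linarith), ← dist_eq_norm]
    nlinarith

end Global

/-! ### Hausdorff measure and normal fields -/

theorem MeasureTheory.euclideanHausdorffMeasure_image_le_of_dist_le {α X Y : Type*} [MetricSpace X]
    [MeasurableSpace X] [BorelSpace X] [MetricSpace Y] [MeasurableSpace Y] [BorelSpace Y]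
    {φ : α → X} {ψ : α → Y} {s : Set α} {c : ℝ≥0}
    (h : ∀ a ∈ s, ∀ b ∈ s, dist (ψ a) (ψ b) ≤ c * dist (φ a) (φ b)) (k : ℕ) :
    μHE[k] (ψ '' s) ≤ (c : ℝ≥0∞) ^ k * μHE[k] (φ '' s) := by
  rcases s.eq_empty_or_nonempty with rfl | ⟨a₀, ha₀⟩
  · simp
  have : Nonempty α := ⟨a₀⟩
  have hinv : ∀ a ∈ s, Function.invFunOn φ s (φ a) ∈ s ∧ φ (Function.invFunOn φ s (φ a)) = φ a :=
    fun a ha => ⟨Function.invFunOn_mem ⟨a, ha, rfl⟩, Function.invFunOn_eq ⟨a, ha, rfl⟩⟩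
  have hlip : LipschitzOnWith c (fun x => ψ (Function.invFunOn φ s x)) (φ '' s) := by
    refine LipschitzOnWith.of_dist_le_mul ?_
    rintro _ ⟨a, ha, rfl⟩ _ ⟨b, hb, rfl⟩
    have := h _ (hinv a ha).1 _ (hinv b hb).1
    rwa [(hinv a ha).2, (hinv b hb).2] at this
  have himg : (fun x => ψ (Function.invFunOn φ s x)) '' (φ '' s) = ψ '' s := by
    rw [image_image]
    refine image_congr fun a ha => ?_
    have := h _ (hinv a ha).1 _ ha
    rw [(hinv a ha).2, dist_self, mul_zero] at this
    exact dist_le_zero.1 this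
  have := hlip.hausdorffMeasure_image_le (d := k) (by positivity)
  rw [himg, ENNReal.rpow_natCast] at this
  simp only [Measure.euclideanHausdorffMeasure_def, Measure.smul_apply, ENNReal.smul_def,
    smul_eq_mul]
  calc _ ≤ _ := mul_le_mul_right this _
    _ = _ := by ring

/-- `n` is a Lipschitz field of unit vectors on `S`, and `S` deviates at most quadratically from the
hyperplanes orthogonal to `n`. -/
structure IsNormalField {E : Type*} [NormedAddCommGroup E] [InnerProductSpace ℝ E] (S : Set E)
    (n : E → E) (L : ℝ) : Prop where
  pos : 0 < L
  norm_eq : ∀ z ∈ S, ‖n z‖ = 1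
  lip : ∀ z ∈ S, ∀ w ∈ S, ‖n z - n w‖ ≤ L * ‖z - w‖
  flat : ∀ z ∈ S, ∀ w ∈ S, |inner ℝ (n z) (w - z)| ≤ L * ‖w - z‖ ^ 2

/-- The map `(s, z) ↦ z + s n(z)`. -/
def normalMap {E : Type*} [NormedAddCommGroup E] [InnerProductSpace ℝ E] (n : E → E)
    (p : ℝ × E) : E := p.2 + p.1 • n p.2

/-- Split the space as `ℝv ⊕ v^⊥` and choose an orthonormal basis of the second summand. -/
theorem exists_isometry_prod {E : Type*} [NormedAddCommGroup E] [InnerProductSpace ℝ E]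
    [FiniteDimensional ℝ E] {k : ℕ} (hk : Module.finrank ℝ E = k + 1) {v : E} (hv : ‖v‖ = 1) :
    ∃ D : E ≃ₗᵢ[ℝ] WithLp 2 (ℝ × EuclideanSpace ℝ (Fin k)),
      D v = WithLp.toLp 2 ((1 : ℝ), (0 : EuclideanSpace ℝ (Fin k))) := by
  have hv0 : v ≠ 0 := by rintro rfl; simp at hv
  have : Fact (Module.finrank ℝ E = k + 1) := ⟨hk⟩
  have hd : Module.finrank ℝ (ℝ ∙ v)ᗮ = k := Submodule.finrank_orthogonal_span_singleton hv0
  let b := (stdOrthonormalBasis ℝ (ℝ ∙ v)ᗮ).reindex (finCongr hd)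
  refine ⟨((ℝ ∙ v).orthogonalDecomposition).trans (LinearIsometryEquiv.withLpProdCongr 2
    (LinearIsometryEquiv.toSpanUnitSingleton v hv).symm b.repr), ?_⟩
  have hmem : v ∈ (ℝ ∙ v) := Submodule.mem_span_singleton_self v
  have h1 : (ℝ ∙ v).orthogonalProjectionOnto v = ⟨v, hmem⟩ :=
    Submodule.orthogonalProjectionOnto_mem_subspace_eq_self (⟨v, hmem⟩ : (ℝ ∙ v))
  have h2 : (ℝ ∙ v)ᗮ.orthogonalProjectionOnto v = 0 := by
    rw [Submodule.orthogonalProjectionOnto_eq_zero_iff, Submodule.orthogonal_orthogonal]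
    exact hmem
  have h3 : (LinearIsometryEquiv.toSpanUnitSingleton v hv).symm ⟨v, hmem⟩ = 1 := by
    rw [LinearIsometryEquiv.symm_apply_eq]
    ext
    simp
  rw [LinearIsometryEquiv.trans_apply, Submodule.orthogonalDecomposition_apply, h1, h2]
  simp [h3]

/-! ### Injectivity of the normal map, and its flattening on a small cell -/

namespace IsNormalField

section Geometry

variable {E : Type*} [NormedAddCommGroup E] [InnerProductSpace ℝ E] {S : Set E} {n : E → E} {L : ℝ}

/-- In the expanded square, flatness bounds the cross term `2s⟨n(z), w - z⟩`. -/
theorem norm_normalMap_sub_sq (h : IsNormalField S n L) {z w : E} (hz : z ∈ S) (hw : w ∈ S)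
    {s : ℝ} (hs : 0 ≤ s) :
    s ^ 2 + (1 - 2 * L * s) * ‖w - z‖ ^ 2 ≤ ‖normalMap n (s, z) - w‖ ^ 2 := by
  have e : normalMap n (s, z) - w = s • n z - (w - z) := by
    simp only [normalMap]; abel
  rw [e, norm_sub_sq_real (s • n z), norm_smul, real_inner_smul_left, h.norm_eq z hz,
    Real.norm_eq_abs, mul_one, sq_abs]
  have := (le_abs_self _).trans (h.flat z hz w hw)
  nlinarith

/-- If `(s, z)` and `(t, w)` have the same image, the inequality for either base point, added up,
leaves a positive multiple of `‖w - z‖²` that is at most zero. -/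
theorem injOn_normalMap (h : IsNormalField S n L) :
    InjOn (normalMap n) (Ioo 0 (1 / (2 * L)) ×ˢ S) := by
  rintro ⟨s, z⟩ ⟨hs, hz⟩ ⟨t, w⟩ ⟨ht, hw⟩ heq
  have hL := h.pos
  dsimp only at hs hz ht hw
  have key : ∀ {s t : ℝ} {z w : E}, s ∈ Ioo 0 (1 / (2 * L)) → t ∈ Ioo 0 (1 / (2 * L)) → z ∈ S →
      w ∈ S → normalMap n (s, z) = normalMap n (t, w) →
      s ^ 2 + (1 - 2 * L * s) * ‖w - z‖ ^ 2 ≤ t ^ 2 := by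
    intro s t z w hs ht hz hw heq
    have h1 := h.norm_normalMap_sub_sq hz hw hs.1.le
    rwa [heq, normalMap, add_sub_cancel_left, norm_smul, h.norm_eq w hw, mul_one,
      Real.norm_eq_abs, sq_abs] at h1
  have h1 := key hs ht hz hw heq
  have h2 := key ht hs hw hz heq.symm
  rw [norm_sub_rev] at h2
  have hs' : 0 < 1 - 2 * L * s := by
    have := (lt_div_iff₀ (by positivity)).1 hs.2
    linarith
  have ht' : 0 < 1 - 2 * L * t := by
    have := (lt_div_iff₀ (by positivity)).1 ht.2
    linarith
  have h3 : ‖w - z‖ ^ 2 ≤ 0 := by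
    by_contra h4
    nlinarith [mul_pos hs' (not_le.1 h4), mul_pos ht' (not_le.1 h4)]
  have h4 : w = z := by
    have : ‖w - z‖ = 0 := by
      have := sq_nonneg ‖w - z‖
      exact pow_eq_zero_iff (two_ne_zero) |>.1 (le_antisymm h3 this)
    exact sub_eq_zero.1 (norm_eq_zero.1 this)
  subst h4
  have h5 : s = t := by
    simp only [sub_self, norm_zero] at h1 h2
    have e : s ^ 2 = t ^ 2 := by
      apply le_antisymm
      · simpa using h1
      · simpa using h2
    exact (sq_eq_sq₀ hs.1.le ht.1.le).1 e
  rw [h5]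

theorem normalMap_notMem (h : IsNormalField S n L) {z : E} (hz : z ∈ S) {s : ℝ}
    (hs : s ∈ Ioo 0 (1 / (2 * L))) : normalMap n (s, z) ∉ S := by
  intro hw
  have hL := h.pos
  have h1 := h.norm_normalMap_sub_sq hz hw hs.1.le
  rw [sub_self, norm_zero] at h1
  have hs' : 0 < 1 - 2 * L * s := by
    have := (lt_div_iff₀ (by positivity)).1 hs.2
    linarith
  have := mul_nonneg hs'.le (sq_nonneg ‖normalMap n (s, z) - z‖)
  nlinarith [hs.1]

end Geometry

section Cell

variable {E : Type*} [NormedAddCommGroup E] [InnerProductSpace ℝ E] {S : Set E} {n : E → E} {L : ℝ}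
  {F : Type*} [NormedAddCommGroup F] [InnerProductSpace ℝ F] {C : Set E} {z₀ : E} {r : ℝ}
  {D : E ≃ₗᵢ[ℝ] WithLp 2 (ℝ × F)}

theorem fst_eq_inner {v : E} (hD : D v = WithLp.toLp 2 ((1 : ℝ), (0 : F))) (z : E) :
    (D z).fst = inner ℝ v z := by
  rw [← D.inner_map_map, hD, WithLp.prod_inner_apply]
  simp

theorem dist_snd_le (z w : E) : dist (D z).snd (D w).snd ≤ dist z w := by
  rw [← D.dist_map, dist_eq_norm, dist_eq_norm, ← WithLp.sub_snd]
  have := WithLp.prod_norm_sq_eq_of_L2 (D z - D w)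
  refine le_of_sq_le_sq ?_ (norm_nonneg _)
  nlinarith [sq_nonneg ‖(D z - D w).fst‖]

/-- On a small piece of `S`, the coordinate orthogonal to the tangent plane varies little. -/
theorem abs_inner_sub_le (h : IsNormalField S n L) (hC : C ⊆ S)
    (hr : ∀ z ∈ C, ∀ w ∈ C, ‖z - w‖ ≤ r) (hz₀ : z₀ ∈ C) {z w : E} (hz : z ∈ C) (hw : w ∈ C) :
    |inner ℝ (n z₀) (w - z)| ≤ 2 * L * r * ‖w - z‖ := by
  have e : inner ℝ (n z₀) (w - z) = inner ℝ (n z) (w - z) + inner ℝ (n z₀ - n z) (w - z) := by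
    rw [← inner_add_left]; congr 1; abel
  have hL := h.pos
  rw [e]
  have h1 := h.flat z (hC hz) w (hC hw)
  have h2 := abs_real_inner_le_norm (n z₀ - n z) (w - z)
  have h3 := h.lip z₀ (hC hz₀) z (hC hz)
  have h4 : L * ‖z₀ - z‖ ≤ L * r := mul_le_mul_of_nonneg_left (hr _ hz₀ _ hz) hL.le
  have h5 : L * ‖w - z‖ ≤ L * r := mul_le_mul_of_nonneg_left (hr _ hw _ hz) hL.le
  refine (abs_add_le _ _).trans ?_
  nlinarith [norm_nonneg (w - z)]

/-- The normal component of `z - w` is at most `2Lr ‖z - w‖`, and `1 / (1 - 2x) ≤ 1 + 4x` for small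
`x`. -/
theorem dist_le_mul_dist_snd (h : IsNormalField S n L) (hC : C ⊆ S)
    (hr : ∀ z ∈ C, ∀ w ∈ C, ‖z - w‖ ≤ r) (hz₀ : z₀ ∈ C)
    (hD : D (n z₀) = WithLp.toLp 2 ((1 : ℝ), (0 : F))) (hLr : 18 * L * r ≤ 1)
    {z w : E} (hz : z ∈ C) (hw : w ∈ C) :
    dist z w ≤ (1 + 4 * L * r) * dist (D z).snd (D w).snd := by
  have h1 := h.abs_inner_sub_le hC hr hz₀ hw hz
  have h2 := WithLp.prod_norm_sq_eq_of_L2 (D z - D w)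
  rw [← map_sub, D.norm_map, fst_eq_inner hD, map_sub, WithLp.sub_snd, Real.norm_eq_abs] at h2
  have hr0 : 0 ≤ r := (norm_nonneg _).trans (hr _ hz₀ _ hz₀)
  have hLr0 : 0 ≤ L * r := mul_nonneg h.pos.le hr0
  rw [dist_eq_norm, dist_eq_norm]
  set a := ‖z - w‖
  set p := ‖(D z).snd - (D w).snd‖
  have ha : 0 ≤ a := norm_nonneg _
  have hp : 0 ≤ p := norm_nonneg _
  have h3 : a ^ 2 ≤ (2 * L * r * a) ^ 2 + p ^ 2 := by
    rw [h2]; gcongr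
  have h4 : a ≤ 2 * L * r * a + p := by
    have : 0 ≤ 2 * L * r * a := by nlinarith
    refine le_of_sq_le_sq ?_ (by positivity)
    nlinarith
  have h5 : (1 - 2 * L * r) * a ≤ p := by linarith
  have h6 : 0 ≤ (1 + 4 * L * r) := by linarith
  have h7 := mul_le_mul_of_nonneg_left h5 h6
  have h8 : 1 ≤ (1 + 4 * L * r) * (1 - 2 * L * r) := by nlinarith
  nlinarith

/-- The flattened coordinates `(s, P z)` of `z + s n(z)`, with `P` the projection to the tangent
plane. -/
noncomputable def flatMap (D : E ≃ₗᵢ[ℝ] WithLp 2 (ℝ × F)) (p : ℝ × E) : ℝ × F := (p.1, (D p.2).snd)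

/-- With `n₀ = n(z₀)`, the difference is `(s - t)(n(z) - n₀) + t(n(z) - n(w)) + ⟨n₀, z - w⟩n₀`. The
terms are at most 1, 2 and 4 times `Lr` times the flat distance, so 9 leaves room. -/
theorem norm_normalMap_sub_flatMap_le (h : IsNormalField S n L) (hC : C ⊆ S)
    (hr : ∀ z ∈ C, ∀ w ∈ C, ‖z - w‖ ≤ r) (hz₀ : z₀ ∈ C)
    (hD : D (n z₀) = WithLp.toLp 2 ((1 : ℝ), (0 : F))) (hLr : 18 * L * r ≤ 1)
    {a b : ℝ × E} (ha : a ∈ Ioo 0 r ×ˢ C) (hb : b ∈ Ioo 0 r ×ˢ C) :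
    ‖(D (normalMap n a) - D (normalMap n b)) -
      (WithLp.toLp 2 (flatMap D a) - WithLp.toLp 2 (flatMap D b))‖ ≤
    9 * L * r * dist (WithLp.toLp 2 (flatMap D a)) (WithLp.toLp 2 (flatMap D b)) := by
  obtain ⟨s, z⟩ := a
  obtain ⟨t, w⟩ := b
  obtain ⟨hs, hz⟩ := ha
  obtain ⟨ht, hw⟩ := hb
  dsimp only at hs hz ht hw
  have hflat : ∀ (s : ℝ) (z : E), WithLp.toLp 2 (flatMap D (s, z)) =
      D z + (s - inner ℝ (n z₀) z) • D (n z₀) := by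
    intro s z
    apply WithLp.ofLp_injective
    ext1
    · rw [hD, ← fst_eq_inner hD]
      simp [flatMap]
    · rw [hD]
      simp [flatMap]
  have e : (D (normalMap n (s, z)) - D (normalMap n (t, w))) -
      (WithLp.toLp 2 (flatMap D (s, z)) - WithLp.toLp 2 (flatMap D (t, w))) =
      D ((s - t) • (n z - n z₀) + t • (n z - n w) + inner ℝ (n z₀) (z - w) • n z₀) := by
    rw [hflat, hflat]
    simp only [normalMap, map_add, map_sub, map_smul, inner_sub_right]
    module
  have hL := h.pos
  have hr0 : 0 < r := hs.1.trans hs.2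
  have hLr0 : 0 < L * r := mul_pos hL hr0
  have h1 := h.lip z (hC hz) z₀ (hC hz₀)
  have h2 := h.lip z (hC hz) w (hC hw)
  have h3 := h.abs_inner_sub_le hC hr hz₀ hw hz
  have h4 := h.dist_le_mul_dist_snd hC hr hz₀ hD hLr hz hw
  have h5 : |s - t| ≤ dist (WithLp.toLp 2 (flatMap D (s, z))) (WithLp.toLp 2 (flatMap D (t, w))) := by
    have := WithLp.prod_norm_sq_eq_of_L2
      (WithLp.toLp 2 (flatMap D (s, z)) - WithLp.toLp 2 (flatMap D (t, w)))
    rw [dist_eq_norm]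
    refine le_of_sq_le_sq ?_ (norm_nonneg _)
    rw [this]
    simp [flatMap, WithLp.sub_fst]
  have h6 : dist (D z).snd (D w).snd ≤
      dist (WithLp.toLp 2 (flatMap D (s, z))) (WithLp.toLp 2 (flatMap D (t, w))) := by
    have := WithLp.prod_norm_sq_eq_of_L2
      (WithLp.toLp 2 (flatMap D (s, z)) - WithLp.toLp 2 (flatMap D (t, w)))
    rw [dist_eq_norm, dist_eq_norm]
    refine le_of_sq_le_sq ?_ (norm_nonneg _)
    rw [this]
    simp [flatMap, WithLp.sub_snd]
    positivity
  rw [e, D.norm_map]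
  set Q := dist (WithLp.toLp 2 (flatMap D (s, z))) (WithLp.toLp 2 (flatMap D (t, w)))
  have hQ : 0 ≤ Q := dist_nonneg
  rw [dist_eq_norm] at h4
  have h7 : ‖z - w‖ ≤ 2 * Q := by
    have : (1 + 4 * L * r) * dist (D z).snd (D w).snd ≤ 2 * Q := by
      gcongr; linarith
    linarith
  have i1 : ‖(s - t) • (n z - n z₀)‖ ≤ Q * (L * r) := by
    rw [norm_smul, Real.norm_eq_abs]
    have : ‖n z - n z₀‖ ≤ L * r := h1.trans (mul_le_mul_of_nonneg_left (hr _ hz _ hz₀) hL.le)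
    gcongr
  have i2 : ‖t • (n z - n w)‖ ≤ r * (L * (2 * Q)) := by
    rw [norm_smul, Real.norm_eq_abs, abs_of_pos ht.1]
    have : ‖n z - n w‖ ≤ L * (2 * Q) := h2.trans (mul_le_mul_of_nonneg_left h7 hL.le)
    have := ht.2.le
    have := ht.1.le
    gcongr
  have i3 : ‖inner ℝ (n z₀) (z - w) • n z₀‖ ≤ 2 * L * r * (2 * Q) := by
    rw [norm_smul, Real.norm_eq_abs, h.norm_eq _ (hC hz₀), mul_one]
    refine h3.trans ?_
    gcongr
  refine (norm_add₃_le).trans ?_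
  nlinarith [mul_nonneg hLr0.le hQ]

theorem dist_normalMap_le (h : IsNormalField S n L) (hC : C ⊆ S)
    (hr : ∀ z ∈ C, ∀ w ∈ C, ‖z - w‖ ≤ r) (hz₀ : z₀ ∈ C)
    (hD : D (n z₀) = WithLp.toLp 2 ((1 : ℝ), (0 : F))) (hLr : 18 * L * r ≤ 1)
    {a b : ℝ × E} (ha : a ∈ Ioo 0 r ×ˢ C) (hb : b ∈ Ioo 0 r ×ˢ C) :
    dist (normalMap n a) (normalMap n b) ≤
      (1 + 18 * L * r) * dist (WithLp.toLp 2 (flatMap D a)) (WithLp.toLp 2 (flatMap D b)) := by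
  have h1 := h.norm_normalMap_sub_flatMap_le hC hr hz₀ hD hLr ha hb
  have h2 := norm_le_norm_add_norm_sub' (D (normalMap n a) - D (normalMap n b))
    (WithLp.toLp 2 (flatMap D a) - WithLp.toLp 2 (flatMap D b))
  have hLr0 : 0 < L * r := mul_pos h.pos (ha.1.1.trans ha.1.2)
  rw [← D.dist_map, dist_eq_norm]
  rw [dist_eq_norm] at h1 ⊢
  nlinarith [mul_nonneg hLr0.le
    (norm_nonneg (WithLp.toLp 2 (flatMap D a) - WithLp.toLp 2 (flatMap D b)))]

/-- Here `18Lr ≤ 1` is what is needed: it gives `1 / (1 - 9x) ≤ 1 + 18x` for `x = Lr`. -/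
theorem dist_flatMap_le (h : IsNormalField S n L) (hC : C ⊆ S)
    (hr : ∀ z ∈ C, ∀ w ∈ C, ‖z - w‖ ≤ r) (hz₀ : z₀ ∈ C)
    (hD : D (n z₀) = WithLp.toLp 2 ((1 : ℝ), (0 : F))) (hLr : 18 * L * r ≤ 1)
    {a b : ℝ × E} (ha : a ∈ Ioo 0 r ×ˢ C) (hb : b ∈ Ioo 0 r ×ˢ C) :
    dist (WithLp.toLp 2 (flatMap D a)) (WithLp.toLp 2 (flatMap D b)) ≤
      (1 + 18 * L * r) * dist (normalMap n a) (normalMap n b) := by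
  have h1 := h.norm_normalMap_sub_flatMap_le hC hr hz₀ hD hLr ha hb
  have h2 := norm_le_norm_add_norm_sub (D (normalMap n a) - D (normalMap n b))
    (WithLp.toLp 2 (flatMap D a) - WithLp.toLp 2 (flatMap D b))
  have hLr0 : 0 < L * r := mul_pos h.pos (ha.1.1.trans ha.1.2)
  rw [← D.dist_map (normalMap n a), dist_eq_norm (D _)]
  rw [dist_eq_norm] at h1 ⊢
  set p := ‖D (normalMap n a) - D (normalMap n b)‖
  set q := ‖WithLp.toLp 2 (flatMap D a) - WithLp.toLp 2 (flatMap D b)‖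
  have hp : 0 ≤ p := norm_nonneg _
  have hq : 0 ≤ q := norm_nonneg _
  have h5 : (1 - 9 * L * r) * q ≤ p := by linarith
  have h7 := mul_le_mul_of_nonneg_left h5 (by linarith : 0 ≤ 1 + 18 * L * r)
  have h8 : 1 ≤ (1 + 18 * L * r) * (1 - 9 * L * r) := by nlinarith
  nlinarith

end Cell
end IsNormalField

/-! ### Measure comparison for the normal map -/

namespace IsNormalField

variable {E : Type*} [NormedAddCommGroup E] [InnerProductSpace ℝ E] [FiniteDimensional ℝ E]
  [MeasurableSpace E] [BorelSpace E] {S : Set E} {n : E → E} {L : ℝ} {k : ℕ} {C : Set E} {r : ℝ}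

theorem measurable_flatMap {F : Type*} [NormedAddCommGroup F] [InnerProductSpace ℝ F]
    [MeasurableSpace F] [BorelSpace F] [SecondCountableTopology F]
    (D : E ≃ₗᵢ[ℝ] WithLp 2 (ℝ × F)) : Measurable (flatMap D) := by
  have : Continuous (flatMap D) := by unfold flatMap; fun_prop
  exact this.measurable

theorem measurable_normalMap (hn : Measurable n) : Measurable (normalMap n) := by
  unfold normalMap
  exact measurable_snd.add (measurable_fst.smul (hn.comp measurable_snd))

omit [FiniteDimensional ℝ E] [MeasurableSpace E] [BorelSpace E] in
theorem injOn_flatMap (h : IsNormalField S n L) {F : Type*} [NormedAddCommGroup F]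
    [InnerProductSpace ℝ F] {D : E ≃ₗᵢ[ℝ] WithLp 2 (ℝ × F)} {z₀ : E} (hC : C ⊆ S)
    (hr : ∀ z ∈ C, ∀ w ∈ C, ‖z - w‖ ≤ r) (hz₀ : z₀ ∈ C)
    (hD : D (n z₀) = WithLp.toLp 2 ((1 : ℝ), (0 : F))) (hLr : 18 * L * r ≤ 1) :
    InjOn (flatMap D) (Ioo 0 r ×ˢ C) := by
  rintro ⟨s, z⟩ ha ⟨t, w⟩ hb heq
  obtain ⟨h1, h2⟩ := Prod.ext_iff.1 heq
  dsimp only [flatMap] at h1 h2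
  have := h.dist_le_mul_dist_snd hC hr hz₀ hD hLr ha.2 hb.2
  dsimp only at this
  rw [h2, dist_self, mul_zero] at this
  rw [h1, dist_le_zero.1 this]

omit [FiniteDimensional ℝ E] in
/-- On a small piece, surface measure is comparable with the Lebesgue measure of the projection to a
tangent plane. -/
theorem surface_comparison (h : IsNormalField S n L)
    {D : E ≃ₗᵢ[ℝ] WithLp 2 (ℝ × EuclideanSpace ℝ (Fin k))} {z₀ : E} (hC : C ⊆ S)
    (hr : ∀ z ∈ C, ∀ w ∈ C, ‖z - w‖ ≤ r) (hz₀ : z₀ ∈ C)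
    (hD : D (n z₀) = WithLp.toLp 2 ((1 : ℝ), (0 : EuclideanSpace ℝ (Fin k))))
    (hLr : 18 * L * r ≤ 1) {T : Set E} (hT : T ⊆ C) :
    μHE[k] T ≤ ENNReal.ofReal (1 + 18 * L * r) ^ k * volume ((fun z => (D z).snd) '' T) ∧
      volume ((fun z => (D z).snd) '' T) ≤ μHE[k] T := by
  have hr0 : 0 ≤ r := (norm_nonneg _).trans (hr _ hz₀ _ hz₀)
  have hLr0 : 0 ≤ L * r := mul_nonneg h.pos.le hr0
  rw [← EuclideanSpace.euclideanHausdorffMeasure_eq_volume]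
  constructor
  · have := euclideanHausdorffMeasure_image_le_of_dist_le (ψ := fun z : E => z)
      (φ := fun z => (D z).snd) (s := T) (c := (1 + 18 * L * r).toNNReal) (fun a ha b hb => by
        refine (h.dist_le_mul_dist_snd hC hr hz₀ hD hLr (hT ha) (hT hb)).trans ?_
        rw [Real.coe_toNNReal _ (by linarith)]
        exact mul_le_mul_of_nonneg_right (by linarith) dist_nonneg) k
    rwa [image_id'] at this
  · have := euclideanHausdorffMeasure_image_le_of_dist_le (ψ := fun z => (D z).snd)
      (φ := fun z : E => z) (s := T) (c := 1) (fun a ha b hb => by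
        simpa using dist_snd_le a b) k
    simpa using this

theorem volume_toLp_image (T : Set (ℝ × EuclideanSpace ℝ (Fin k))) :
    μHE[k + 1] (WithLp.toLp 2 '' T) = volume T := by
  have hfin : Module.finrank ℝ (WithLp 2 (ℝ × EuclideanSpace ℝ (Fin k))) = k + 1 := by
    rw [(WithLp.linearEquiv 2 ℝ (ℝ × EuclideanSpace ℝ (Fin k))).finrank_eq]
    simp [add_comm]
  rw [← hfin, InnerProductSpace.euclideanHausdorffMeasure_eq_volume]
  have := (WithLp.volume_preserving_symm_measurableEquiv_toLp_prod ℝ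
    (EuclideanSpace ℝ (Fin k))).measure_preimage_equiv T
  rw [← this]
  congr 1
  exact ((MeasurableEquiv.toLp 2 (ℝ × EuclideanSpace ℝ (Fin k))).image_eq_preimage_symm T)

/-- On a small piece of `S`, the map `(s, z) ↦ z + s n(z)` almost preserves measure. -/
theorem cell_comparison (h : IsNormalField S n L) (hk : Module.finrank ℝ E = k + 1)
    [SFinite ((μHE[k] : Measure E).restrict S)]
    (hC : C ⊆ S) (hr : ∀ z ∈ C, ∀ w ∈ C, ‖z - w‖ ≤ r) (hLr : 18 * L * r ≤ 1)
    {T : Set (ℝ × E)} (hT : MeasurableSet T) (hTC : T ⊆ Ioo 0 r ×ˢ C) :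
    ((volume : Measure ℝ).prod (μHE[k].restrict S)) T ≤
      ENNReal.ofReal (1 + 18 * L * r) ^ (2 * k + 1) * volume (normalMap n '' T) ∧
    volume (normalMap n '' T) ≤ ENNReal.ofReal (1 + 18 * L * r) ^ (2 * k + 1) *
      ((volume : Measure ℝ).prod (μHE[k].restrict S)) T := by
  rcases T.eq_empty_or_nonempty with rfl | ⟨⟨s₀, z₀⟩, h₀⟩
  · simp
  have hz₀ : z₀ ∈ C := (hTC h₀).2
  have hr0 : 0 ≤ r := (norm_nonneg _).trans (hr _ hz₀ _ hz₀)
  have hLr0 : 0 ≤ L * r := mul_nonneg h.pos.le hr0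
  obtain ⟨D, hD⟩ := exists_isometry_prod hk (h.norm_eq z₀ (hC hz₀))
  set c : ℝ≥0∞ := ENNReal.ofReal (1 + 18 * L * r) with hc
  have hc1 : 1 ≤ c := by
    rw [hc, ENNReal.one_le_ofReal]; linarith
  have hctop : c ≠ ⊤ := ENNReal.ofReal_ne_top
  have hcoe : ((1 + 18 * L * r).toNNReal : ℝ) = 1 + 18 * L * r :=
    Real.coe_toNNReal _ (by linarith)
  have hflat : MeasurableSet (flatMap D '' T) :=
    hT.image_of_measurable_injOn (measurable_flatMap D)
      ((h.injOn_flatMap hC hr hz₀ hD hLr).mono hTC)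
  have e1 : volume (normalMap n '' T) ≤ c ^ (k + 1) * volume (flatMap D '' T) := by
    have := euclideanHausdorffMeasure_image_le_of_dist_le (ψ := normalMap n)
      (φ := fun a => WithLp.toLp 2 (flatMap D a)) (s := T) (c := (1 + 18 * L * r).toNNReal)
      (fun a ha b hb => by
        rw [hcoe]
        exact h.dist_normalMap_le hC hr hz₀ hD hLr (hTC ha) (hTC hb)) (k + 1)
    rwa [← image_image (WithLp.toLp 2), volume_toLp_image, ← hk,
      InnerProductSpace.euclideanHausdorffMeasure_eq_volume, hk] at this
  have e2 : volume (flatMap D '' T) ≤ c ^ (k + 1) * volume (normalMap n '' T) := by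
    have := euclideanHausdorffMeasure_image_le_of_dist_le (φ := normalMap n)
      (ψ := fun a => WithLp.toLp 2 (flatMap D a)) (s := T) (c := (1 + 18 * L * r).toNNReal)
      (fun a ha b hb => by
        rw [hcoe]
        exact h.dist_flatMap_le hC hr hz₀ hD hLr (hTC ha) (hTC hb)) (k + 1)
    rwa [← image_image (WithLp.toLp 2), volume_toLp_image, ← hk,
      InnerProductSpace.euclideanHausdorffMeasure_eq_volume, hk] at this
  have hsec : ∀ s, Prod.mk s ⁻¹' T ⊆ C := fun s z hz => (hTC hz).2
  have hsecD : ∀ s, Prod.mk s ⁻¹' (flatMap D '' T) = (fun z => (D z).snd) '' (Prod.mk s ⁻¹' T) := by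
    intro s
    ext u
    simp only [flatMap, mem_preimage, mem_image, Prod.mk.injEq, Prod.exists]
    constructor
    · rintro ⟨t, z, hz, rfl, rfl⟩
      exact ⟨z, hz, rfl⟩
    · rintro ⟨z, hz, rfl⟩
      exact ⟨s, z, hz, rfl, rfl⟩
  -- Slicing at fixed `s` on both sides reduces the product measure to the comparison of surface
  -- measure with its projection.
  have hprod : ((volume : Measure ℝ).prod (μHE[k].restrict S)) T =
      ∫⁻ s, μHE[k] (Prod.mk s ⁻¹' T) := by
    rw [Measure.prod_apply hT]
    refine lintegral_congr fun s => ?_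
    rw [Measure.restrict_apply (measurable_prodMk_left hT),
      inter_eq_left.2 ((hsec s).trans hC)]
  have hvol : volume (flatMap D '' T) =
      ∫⁻ s, volume ((fun z => (D z).snd) '' (Prod.mk s ⁻¹' T)) := by
    rw [Measure.volume_eq_prod, Measure.prod_apply hflat]
    exact lintegral_congr fun s => by rw [hsecD]
  have e3 : ((volume : Measure ℝ).prod (μHE[k].restrict S)) T ≤
      c ^ k * volume (flatMap D '' T) := by
    rw [hprod, hvol, ← lintegral_const_mul' _ _ (ENNReal.pow_ne_top hctop)]
    exact lintegral_mono fun s => (h.surface_comparison hC hr hz₀ hD hLr (hsec s)).1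
  have e4 : volume (flatMap D '' T) ≤ ((volume : Measure ℝ).prod (μHE[k].restrict S)) T := by
    rw [hprod, hvol]
    exact lintegral_mono fun s => (h.surface_comparison hC hr hz₀ hD hLr (hsec s)).2
  -- One direction costs `k` powers on slices and `k + 1` on the full space; the other only `k + 1`,
  -- since projecting does not increase measure.
  constructor
  · calc _ ≤ c ^ k * (c ^ (k + 1) * volume (normalMap n '' T)) := e3.trans (by gcongr)
      _ = _ := by rw [← mul_assoc, ← pow_add]; congr 2; omega
  · calc _ ≤ c ^ (k + 1) * ((volume : Measure ℝ).prod (μHE[k].restrict S)) T :=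
          e1.trans (by gcongr)
      _ ≤ _ := by gcongr; exacts [by omega]

theorem surface_lt_top (h : IsNormalField S n L) (hk : Module.finrank ℝ E = k + 1)
    (hS : IsCompact S) : μHE[k] S < ⊤ := by
  refine hS.measure_lt_top_of_nhdsWithin fun z₀ hz₀ => ?_
  have hL := h.pos
  set r : ℝ := 1 / (18 * L)
  have hr : 0 < r := by positivity
  refine ⟨S ∩ Metric.ball z₀ (r / 2), inter_mem_nhdsWithin _ (Metric.ball_mem_nhds _ (by positivity)),
    ?_⟩
  obtain ⟨D, hD⟩ := exists_isometry_prod hk (h.norm_eq z₀ hz₀)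
  have hdiam : ∀ z ∈ S ∩ Metric.ball z₀ (r / 2), ∀ w ∈ S ∩ Metric.ball z₀ (r / 2), ‖z - w‖ ≤ r := by
    intro z hz w hw
    rw [← dist_eq_norm]
    have := dist_triangle_right z w z₀
    linarith [Metric.mem_ball.1 hz.2, Metric.mem_ball.1 hw.2]
  have h1 := (h.surface_comparison (T := S ∩ Metric.ball z₀ (r / 2)) inter_subset_left hdiam
    ⟨hz₀, Metric.mem_ball_self (by positivity)⟩ hD
    (by simp only [r]; field_simp; rfl) subset_rfl).1
  refine h1.trans_lt (ENNReal.mul_lt_top (ENNReal.pow_lt_top ENNReal.ofReal_lt_top) ?_)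
  refine (measure_mono (t := Metric.closedBall (D z₀).snd (r / 2)) ?_).trans_lt
    measure_closedBall_lt_top
  rintro _ ⟨z, hz, rfl⟩
  exact (dist_snd_le z z₀).trans (Metric.mem_ball.1 hz.2).le

/-- Disjointed balls of radius `r / 2` cut `S` into cells. Injectivity keeps their images disjoint
and measurable, so the cell estimates add up. -/
theorem comparison (h : IsNormalField S n L) (hk : Module.finrank ℝ E = k + 1) (hS : IsCompact S)
    (hn : Measurable n) (hr : 0 < r) (hLr : 18 * L * r ≤ 1)
    {T : Set (ℝ × E)} (hT : MeasurableSet T) (hTS : T ⊆ Ioo 0 r ×ˢ S) :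
    ((volume : Measure ℝ).prod (μHE[k].restrict S)) T ≤
      ENNReal.ofReal (1 + 18 * L * r) ^ (2 * k + 1) * volume (normalMap n '' T) ∧
    volume (normalMap n '' T) ≤ ENNReal.ofReal (1 + 18 * L * r) ^ (2 * k + 1) *
      ((volume : Measure ℝ).prod (μHE[k].restrict S)) T := by
  have : IsFiniteMeasure ((μHE[k] : Measure E).restrict S) :=
    ⟨by rw [Measure.restrict_apply_univ]; exact h.surface_lt_top hk hS⟩
  let B : ℕ → Set E := disjointed fun i => Metric.ball (TopologicalSpace.denseSeq E i) (r / 2)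
  have hBm : ∀ i, MeasurableSet (B i) :=
    fun i => MeasurableSet.disjointed (fun _ => measurableSet_ball) i
  have hBd : Pairwise (Function.onFun Disjoint B) := disjoint_disjointed _
  have hBu : ⋃ i, B i = univ := by
    rw [iUnion_disjointed, eq_univ_iff_forall]
    intro x
    obtain ⟨i, hi⟩ := (TopologicalSpace.denseRange_denseSeq E).exists_dist_lt x (half_pos hr)
    exact mem_iUnion.2 ⟨i, hi⟩
  let T' : ℕ → Set (ℝ × E) := fun i => T ∩ Prod.snd ⁻¹' B i
  have hTm : ∀ i, MeasurableSet (T' i) := fun i => hT.inter (measurable_snd (hBm i))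
  have hTd : Pairwise (Function.onFun Disjoint T') := fun i j hij =>
    ((hBd hij).preimage Prod.snd).mono inter_subset_right inter_subset_right
  have hTu : T = ⋃ i, T' i := by
    rw [← inter_iUnion, ← preimage_iUnion, hBu, preimage_univ, inter_univ]
  have hinj : InjOn (normalMap n) T := by
    refine h.injOn_normalMap.mono (hTS.trans (prod_mono (Ioo_subset_Ioo_right ?_) subset_rfl))
    have := h.pos
    rw [le_div_iff₀ (by positivity)]
    nlinarith
  have hT'T : ∀ i, T' i ⊆ T := fun i => inter_subset_left
  have hIm : ∀ i, MeasurableSet (normalMap n '' T' i) := fun i =>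
    (hTm i).image_of_measurable_injOn (measurable_normalMap hn) (hinj.mono (hT'T i))
  have hId : Pairwise (Function.onFun Disjoint fun i => normalMap n '' T' i) := by
    intro i j hij
    exact (hTd hij).image hinj (hT'T i) (hT'T j)
  have hBball : ∀ i, B i ⊆ Metric.ball (TopologicalSpace.denseSeq E i) (r / 2) := fun i =>
    disjointed_subset (fun i => Metric.ball (TopologicalSpace.denseSeq E i) (r / 2)) i
  have hcell : ∀ i, _ := fun i => h.cell_comparison (k := k) hk (C := S ∩ B i) inter_subset_left
    (r := r) (fun z hz w hw => by
      have h1 := Metric.mem_ball.1 (hBball i hz.2)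
      have h2 := Metric.mem_ball.1 (hBball i hw.2)
      rw [← dist_eq_norm]
      linarith [dist_triangle_right z w (TopologicalSpace.denseSeq E i)]) hLr (hTm i)
    (fun p hp => ⟨(hTS hp.1).1, (hTS hp.1).2, hp.2⟩)
  have s1 : ((volume : Measure ℝ).prod (μHE[k].restrict S)) T =
      ∑' i, ((volume : Measure ℝ).prod (μHE[k].restrict S)) (T' i) := by
    conv_lhs => rw [hTu]
    exact measure_iUnion hTd hTm
  have s2 : volume (normalMap n '' T) = ∑' i, volume (normalMap n '' T' i) := by
    conv_lhs => rw [hTu, image_iUnion]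
    exact measure_iUnion hId hIm
  rw [s1, s2, ← ENNReal.tsum_mul_left, ← ENNReal.tsum_mul_left]
  exact ⟨ENNReal.tsum_le_tsum fun i => (hcell i).1, ENNReal.tsum_le_tsum fun i => (hcell i).2⟩

end IsNormalField

/-- By convexity on `[0, 1]` the power lies below its chord `1 + (2 ^ m - 1)x`. -/
theorem one_add_pow_le {x : ℝ} (hx : 0 ≤ x) (hx1 : x ≤ 1) (m : ℕ) :
    (1 + x) ^ m ≤ 1 + 2 ^ m * x := by
  have key : (1 + x) ^ m ≤ 1 + (2 ^ m - 1) * x := by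
    induction m with
    | zero => simp
    | succ m ih =>
      have h2 : (1 : ℝ) ≤ 2 ^ m := one_le_pow₀ (by norm_num)
      rw [pow_succ, pow_succ]
      nlinarith [mul_nonneg (sub_nonneg.2 h2) (mul_nonneg hx (sub_nonneg.2 hx1))]
  nlinarith

theorem abs_integral_sub_integral_le {X : Type*} [MeasurableSpace X] {μ ν : Measure X} {x : ℝ}
    (hx : 0 ≤ x) (h1 : μ ≤ ENNReal.ofReal (1 + x) • ν)
    (h2 : ν ≤ ENNReal.ofReal (1 + x) • μ) {g : X → ℝ} (hg : ∀ y, 0 ≤ g y)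
    (hgμ : Integrable g μ) (hgν : Integrable g ν) :
    |∫ y, g y ∂μ - ∫ y, g y ∂ν| ≤ 2 * x * ∫ y, g y ∂ν := by
  have i1 := integral_mono_measure h1 (ae_of_all _ hg) (hgν.smul_measure ENNReal.ofReal_ne_top)
  have i2 := integral_mono_measure h2 (ae_of_all _ hg) (hgμ.smul_measure ENNReal.ofReal_ne_top)
  rw [integral_smul_measure, ENNReal.toReal_ofReal (by linarith), smul_eq_mul] at i1 i2
  have p1 : 0 ≤ ∫ y, g y ∂μ := integral_nonneg hg
  have p2 : 0 ≤ ∫ y, g y ∂ν := integral_nonneg hg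
  rw [abs_le]
  constructor <;> nlinarith [mul_nonneg hx p2]

/-! ### From the normal map to the boundary layer -/

section Layer

variable {d : ℕ} {A : Set (EuclideanSpace ℝ (Fin d))} {L r : ℝ}
  {n : EuclideanSpace ℝ (Fin d) → EuclideanSpace ℝ (Fin d)}

/-- The normal segment never meets `∂A` again and starts out in `A`, so by connectedness it stays in
the interior. -/
theorem normalMap_mem_interior (hC11 : HasC11Boundary A) (hreg : A = closure (interior A))
    (hn : EqOn n (innerNormal A) (frontier A)) (h : IsNormalField (frontier A) n L)
    {z : EuclideanSpace ℝ (Fin d)} (hz : z ∈ frontier A) {s : ℝ} (hs : s ∈ Ioo 0 (1 / (2 * L))) :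
    normalMap n (s, z) ∈ interior A := by
  have hL := h.pos
  have hc : Continuous fun t : ℝ => normalMap n (t, z) :=
    show Continuous fun t : ℝ => z + t • n z by fun_prop
  have hpre := ((convex_Ioo (0 : ℝ) (1 / (2 * L))).isPreconnected.image _ hc.continuousOn)
  have hdisj : Disjoint ((fun t : ℝ => normalMap n (t, z)) '' Ioo 0 (1 / (2 * L)))
      (frontier A) := by
    rw [Set.disjoint_left]
    rintro _ ⟨t, ht, rfl⟩
    exact h.normalMap_notMem hz ht
  rcases hpre.subset_interior_or_subset_compl_closure hdisj with h1 | h1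
  · exact h1 ⟨s, hs, rfl⟩
  · exfalso
    have h2 := (hC11.isInnerUnitNormal_innerNormal hreg hz).2.2
    obtain ⟨t, ht1, ht2⟩ := (h2.and (Ioo_mem_nhdsGT (show 0 < 1 / (2 * L) by positivity))).exists
    refine h1 ⟨t, ht2, rfl⟩ (subset_closure ?_)
    simpa only [normalMap, hn hz] using ht1

theorem boundaryLayer_subset : boundaryLayer A r ⊆ A := inter_subset_left

theorem measurableSet_boundaryLayer (hA : IsClosed A) : MeasurableSet (boundaryLayer A r) :=
  hA.measurableSet.inter (isOpen_biUnion fun _ _ => Metric.isOpen_ball).measurableSet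

theorem normalMap_image (hC11 : HasC11Boundary A) (hreg : A = closure (interior A))
    (hbdd : Bornology.IsBounded A)
    (hn : EqOn n (innerNormal A) (frontier A)) (h : IsNormalField (frontier A) n L)
    (hr : r ≤ 1 / (2 * L)) :
    normalMap n '' (Ioo 0 r ×ˢ frontier A) = boundaryLayer A r \ frontier A := by
  have hcl : IsClosed A := hreg ▸ isClosed_closure
  have hcpt : IsCompact (frontier A) :=
    (Metric.isCompact_of_isClosed_isBounded hcl hbdd).of_isClosed_subset isClosed_frontier
      hcl.frontier_subset
  ext y
  constructor
  · rintro ⟨⟨s, z⟩, ⟨hs, hz⟩, rfl⟩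
    dsimp only at hs hz
    have hs' : s ∈ Ioo 0 (1 / (2 * L)) := ⟨hs.1, hs.2.trans_le hr⟩
    refine ⟨⟨interior_subset (normalMap_mem_interior hC11 hreg hn h hz hs'), ?_⟩,
      h.normalMap_notMem hz hs'⟩
    refine mem_iUnion₂.2 ⟨z, hz, ?_⟩
    rw [Metric.mem_ball, dist_eq_norm, normalMap, add_sub_cancel_left, norm_smul, h.norm_eq z hz,
      mul_one, Real.norm_eq_abs, abs_of_pos hs.1]
    exact hs.2
  · rintro ⟨⟨hyA, hy⟩, hyf⟩
    obtain ⟨x, hx, hyx⟩ := mem_iUnion₂.1 hy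
    obtain ⟨z, hz, hyz⟩ := hcpt.exists_infDist_eq_dist ⟨x, hx⟩ y
    have hmin : ∀ p ∈ frontier A, dist y z ≤ dist y p := fun p hp =>
      hyz ▸ Metric.infDist_le_dist_of_mem hp
    have hyi : y ∈ interior A := by
      by_contra hc
      exact hyf ⟨subset_closure hyA, hc⟩
    have hpos : 0 < dist y z := dist_pos.2 fun e => hyf (e ▸ hz)
    refine ⟨(dist y z, z), ⟨⟨hpos, (hmin x hx).trans_lt hyx⟩, hz⟩, ?_⟩
    rw [normalMap, hn hz]
    exact (hC11.sub_eq_smul_innerNormal hreg hyi hz hmin).symm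

/-- Finite Hausdorff measure in a lower dimension forces measure zero in dimension `d`. -/
theorem volume_frontier_eq_zero {k : ℕ} (hk : d = k + 1)
    (h : (μHE[k] : Measure (EuclideanSpace ℝ (Fin d))) (frontier A) < ⊤) :
    volume (frontier A) = 0 := by
  have := Measure.euclideanHausdorffMeasure_zero_or_top (show k < d by omega) (frontier A)
  rw [EuclideanSpace.euclideanHausdorffMeasure_eq_volume] at this
  exact this.resolve_right h.ne

/-- The product of Lebesgue measure on `(0, r)` and surface measure, pushed forward along the inner
normals, is comparable with Lebesgue measure on the boundary layer. -/
theorem layer_comparison {k : ℕ} (hk : d = k + 1) (hC11 : HasC11Boundary A)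
    (hreg : A = closure (interior A)) (hbdd : Bornology.IsBounded A)
    (hn : EqOn n (innerNormal A) (frontier A)) (hnm : Measurable n)
    (h : IsNormalField (frontier A) n L) (hr : 0 < r) (hLr : 18 * L * r ≤ 1) :
    ((volume.restrict (Ioo 0 r)).prod (μHE[k].restrict (frontier A))).map (normalMap n) ≤
      ENNReal.ofReal (1 + 18 * L * r) ^ (2 * k + 1) • volume.restrict (boundaryLayer A r) ∧
    volume.restrict (boundaryLayer A r) ≤ ENNReal.ofReal (1 + 18 * L * r) ^ (2 * k + 1) •
      ((volume.restrict (Ioo 0 r)).prod (μHE[k].restrict (frontier A))).map (normalMap n) := by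
  have hL := h.pos
  have hcl : IsClosed A := hreg ▸ isClosed_closure
  have hcpt : IsCompact (frontier A) :=
    (Metric.isCompact_of_isClosed_isBounded hcl hbdd).of_isClosed_subset isClosed_frontier
      hcl.frontier_subset
  have hfr : Module.finrank ℝ (EuclideanSpace ℝ (Fin d)) = k + 1 := by simp [hk]
  have htop := h.surface_lt_top hfr hcpt
  have : IsFiniteMeasure ((μHE[k] : Measure (EuclideanSpace ℝ (Fin d))).restrict (frontier A)) :=
    ⟨by rwa [Measure.restrict_apply_univ]⟩
  have hm : ((volume : Measure ℝ).restrict (Ioo 0 r)).prod (μHE[k].restrict (frontier A)) =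
      ((volume : Measure ℝ).prod (μHE[k].restrict (frontier A))).restrict
        (Ioo 0 r ×ˢ frontier A) := by
    rw [← Measure.prod_restrict, Measure.restrict_restrict hcpt.measurableSet, inter_self]
  have hNm := IsNormalField.measurable_normalMap hnm
  have hZ : MeasurableSet (Ioo 0 r ×ˢ frontier A) :=
    measurableSet_Ioo.prod hcpt.measurableSet
  have hr2 : r ≤ 1 / (2 * L) := by
    rw [le_div_iff₀ (by positivity)]
    nlinarith
  have key : ∀ B, MeasurableSet B →
      (((volume.restrict (Ioo 0 r)).prod (μHE[k].restrict (frontier A))).map (normalMap n)) B =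
        ((volume : Measure ℝ).prod (μHE[k].restrict (frontier A)))
          (normalMap n ⁻¹' B ∩ Ioo 0 r ×ˢ frontier A) := fun B hB => by
    rw [Measure.map_apply hNm hB, hm, Measure.restrict_apply (hNm hB)]
  have hcomp := fun B (hB : MeasurableSet B) =>
    h.comparison hfr hcpt hnm hr hLr ((hNm hB).inter hZ) inter_subset_right
  have himg : ∀ B, normalMap n '' (normalMap n ⁻¹' B ∩ Ioo 0 r ×ˢ frontier A) =
      B ∩ (boundaryLayer A r \ frontier A) := fun B => by
    rw [image_preimage_inter, normalMap_image hC11 hreg hbdd hn h hr2]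
  constructor
  · refine Measure.le_iff.2 fun B hB => ?_
    rw [key B hB, Measure.smul_apply, Measure.restrict_apply hB, smul_eq_mul]
    refine (hcomp B hB).1.trans ?_
    rw [himg]
    gcongr
    exact sdiff_subset
  · refine Measure.le_iff.2 fun B hB => ?_
    rw [Measure.smul_apply, key B hB, Measure.restrict_apply hB, smul_eq_mul]
    refine le_trans ?_ (hcomp B hB).2
    rw [himg, ← inter_sdiff_assoc,
      measure_sdiff_null (volume_frontier_eq_zero hk htop)]

end Layer

/-! ### The reparameterization estimate -/

/-- The function `ψ : A → [0, ∞)` is represented by a function on `ℝ^d` of which only the restriction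
to `A` matters. Finiteness of the surface measure, and existence of all the integrals, are part of
the conclusion. -/
theorem proposition3p7 (d : ℕ) (hd : 2 ≤ d) (A : Set (EuclideanSpace ℝ (Fin d)))
    (hbdd : Bornology.IsBounded A) (hC11 : HasC11Boundary A) (hreg : A = closure (interior A)) :
    surfaceMeasure A univ < ⊤ ∧
    ∃ c r₀ : ℝ, 0 < c ∧ 0 < r₀ ∧
      (∀ z ∈ frontier A, ∀ s ∈ Icc 0 r₀, z + s • innerNormal A z ∈ A) ∧
      ∀ r ∈ Ioo 0 r₀, ∀ ψ : EuclideanSpace ℝ (Fin d) → ℝ,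
        Measurable (A.domRestrict ψ) → (∀ y ∈ A, 0 ≤ ψ y) → (∃ M : ℝ, ∀ y ∈ A, ψ y ≤ M) →
        IntegrableOn ψ (boundaryLayer A r) ∧
        Integrable (fun p : ℝ × EuclideanSpace ℝ (Fin d) => ψ (p.2 + p.1 • innerNormal A p.2))
          ((volume.restrict (Ioc 0 r)).prod (surfaceMeasure A)) ∧
        |(∫ y in boundaryLayer A r, ψ y) - normalIntegral A ψ r| ≤ c * r * normalIntegral A ψ r ∧
        ∀ Ψ : ℝ → ℝ,
          (∀ z ∈ frontier A, ∀ s ∈ Ioo 0 r₀, ψ (z + s • innerNormal A z) = Ψ s) →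
          (A.Nonempty → IntervalIntegrable Ψ volume 0 r) ∧
          |(∫ y in boundaryLayer A r, ψ y) - perimeter A * ∫ s in (0 : ℝ)..r, Ψ s|
            ≤ c * r * (perimeter A * ∫ s in (0 : ℝ)..r, Ψ s) := by
  classical
  have hdk : d = (d - 1) + 1 := by omega
  have hcl : IsClosed A := hreg ▸ isClosed_closure
  have hcpt : IsCompact (frontier A) :=
    (Metric.isCompact_of_isClosed_isBounded hcl hbdd).of_isClosed_subset isClosed_frontier
      hcl.frontier_subset
  have hfr : Module.finrank ℝ (EuclideanSpace ℝ (Fin d)) = (d - 1) + 1 := by simp; omega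
  obtain ⟨L, hL, hbound⟩ := hC11.exists_bound hreg hbdd
  set S := frontier A with hS
  -- Off `∂A` the chosen normal is arbitrary; setting it to zero there makes the field measurable.
  set n : EuclideanSpace ℝ (Fin d) → EuclideanSpace ℝ (Fin d) :=
    S.piecewise (innerNormal A) 0 with hndef
  have hn : EqOn n (innerNormal A) S := fun z hz => piecewise_eq_of_mem _ _ _ hz
  have hnm : Measurable n := by
    refine ContinuousOn.measurable_piecewise ?_ continuousOn_const hcpt.measurableSet
    refine LipschitzOnWith.continuousOn (K := L.toNNReal) (LipschitzOnWith.of_dist_le_mul ?_)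
    intro z hz w hw
    rw [dist_eq_norm, dist_eq_norm, Real.coe_toNNReal _ hL.le]
    exact (hbound z hz w hw).1
  have h : IsNormalField S n L :=
    { pos := hL
      norm_eq := fun z hz => by
        rw [hn hz]; exact (hC11.isInnerUnitNormal_innerNormal hreg hz).1
      lip := fun z hz w hw => by
        rw [hn hz, hn hw]; exact (hbound z hz w hw).1
      flat := fun z hz w hw => by
        rw [hn hz]; exact (hbound z hz w hw).2 }
  have htop := h.surface_lt_top hfr hcpt
  have hfin : IsFiniteMeasure (surfaceMeasure A) :=
    ⟨by rw [surfaceMeasure, Measure.restrict_apply_univ]; exact htop⟩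
  set m := 2 * (d - 1) + 1
  -- `18L` is the cell constant and `2 ^ m` comes from `one_add_pow_le`, so the measures compare
  -- with factor `1 + a * r`. The choice `r₀ = 1 / a` lies strictly below `1 / (2 * L)`, keeping
  -- closed normal segments in `A`.
  set a : ℝ := 18 * L * 2 ^ m with ha
  have hapos : 0 < a := by positivity
  have ha18 : 18 * L ≤ a := by
    have : (1 : ℝ) ≤ 2 ^ m := one_le_pow₀ (by norm_num)
    nlinarith
  have hr₀L : 1 / a < 1 / (2 * L) := one_div_lt_one_div_of_lt (by positivity) (by linarith)
  have hmemA : ∀ z ∈ S, ∀ s ∈ Icc 0 (1 / a), z + s • innerNormal A z ∈ A := by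
    intro z hz s hs
    rcases hs.1.eq_or_lt with rfl | hs0
    · simpa using hcl.frontier_subset hz
    · have := interior_subset (normalMap_mem_interior hC11 hreg hn h hz
        ⟨hs0, hs.2.trans_lt hr₀L⟩)
      rwa [normalMap, hn hz] at this
  refine ⟨measure_lt_top _ _, 2 * a, 1 / a, by positivity, by positivity, hmemA, ?_⟩
  rintro r ⟨hr, hr₀⟩ ψ hψm hψ0 ⟨M, hM⟩
  have har : a * r < 1 := by rwa [lt_div_iff₀ hapos, mul_comm] at hr₀
  have hLr : 18 * L * r ≤ 1 := by nlinarith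
  set Z := Ioo 0 r ×ˢ S
  set μ := ((volume : Measure ℝ).restrict (Ioo 0 r)).prod (surfaceMeasure A) with hμ
  have hIoc : ((volume : Measure ℝ).restrict (Ioc 0 r)).prod (surfaceMeasure A) = μ := by
    rw [hμ, Measure.restrict_congr_set Ioo_ae_eq_Ioc]
  have hNm := IsNormalField.measurable_normalMap hnm
  have hμZ : ∀ᵐ p ∂μ, p ∈ Z := by
    have e : μ = ((volume : Measure ℝ).prod (surfaceMeasure A)).restrict Z := by
      rw [← Measure.prod_restrict, surfaceMeasure, Measure.restrict_restrict hcpt.measurableSet,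
        inter_self, hμ, surfaceMeasure]
    rw [e]
    exact ae_restrict_mem (measurableSet_Ioo.prod hcpt.measurableSet)
  -- Only the restriction of `ψ` to `A` is controlled, hence the extension by zero.
  set g : EuclideanSpace ℝ (Fin d) → ℝ := A.piecewise ψ 0 with hg
  have hgψ : EqOn g ψ A := fun y hy => piecewise_eq_of_mem _ _ _ hy
  have hgm : Measurable g := by
    refine measurable_of_restrict_of_restrict_compl hcl.measurableSet ?_ ?_
    · rwa [hg, domRestrict_piecewise]
    · rw [hg, domRestrict_piecewise_compl]
      exact measurable_zero.comp measurable_subtype_coe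
  have hg0 : ∀ y, 0 ≤ g y := fun y => by
    by_cases hy : y ∈ A
    · rw [hgψ hy]; exact hψ0 y hy
    · rw [hg, piecewise_eq_of_notMem _ _ _ hy]; rfl
  have hgM : ∀ y, ‖g y‖ ≤ max M 0 := fun y => by
    rw [Real.norm_eq_abs, abs_of_nonneg (hg0 y)]
    by_cases hy : y ∈ A
    · rw [hgψ hy]; exact (hM y hy).trans (le_max_left _ _)
    · rw [hg, piecewise_eq_of_notMem _ _ _ hy]; exact le_max_right _ _
  have hlayer : MeasurableSet (boundaryLayer A r) := measurableSet_boundaryLayer hcl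
  have hlayer_top : volume (boundaryLayer A r) < ⊤ :=
    (hbdd.subset boundaryLayer_subset).measure_lt_top
  have hfin2 : IsFiniteMeasure (volume.restrict (boundaryLayer A r)) :=
    ⟨by rwa [Measure.restrict_apply_univ]⟩
  have hI1 : Integrable g (volume.restrict (boundaryLayer A r)) :=
    Integrable.of_bound hgm.aestronglyMeasurable _ (ae_of_all _ hgM)
  have hI2 : Integrable g (μ.map (normalMap n)) :=
    Integrable.of_bound hgm.aestronglyMeasurable _ (ae_of_all _ hgM)
  have hae : (fun p : ℝ × EuclideanSpace ℝ (Fin d) => ψ (p.2 + p.1 • innerNormal A p.2)) =ᵐ[μ]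
      g ∘ normalMap n := by
    filter_upwards [hμZ] with p hp
    have h1 : p.2 + p.1 • innerNormal A p.2 ∈ A :=
      hmemA _ hp.2 _ ⟨hp.1.1.le, (hp.1.2.trans hr₀).le⟩
    rw [Function.comp_apply, normalMap, hn hp.2, hgψ h1]
  have hI3 : Integrable
      (fun p : ℝ × EuclideanSpace ℝ (Fin d) => ψ (p.2 + p.1 • innerNormal A p.2)) μ :=
    ((integrable_map_measure hgm.aestronglyMeasurable hNm.aemeasurable).1 hI2).congr hae.symm
  have hE1 : ∫ y in boundaryLayer A r, ψ y = ∫ y in boundaryLayer A r, g y :=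
    setIntegral_congr_fun hlayer fun y hy => (hgψ (boundaryLayer_subset hy)).symm
  have hE2 : normalIntegral A ψ r = ∫ y, g y ∂(μ.map (normalMap n)) := by
    rw [integral_map hNm.aemeasurable hgm.aestronglyMeasurable, normalIntegral,
      intervalIntegral.integral_of_le hr.le, integral_Ioc_eq_integral_Ioo, ← integral_prod _ hI3]
    exact integral_congr_ae hae
  have hmain : |(∫ y in boundaryLayer A r, ψ y) - normalIntegral A ψ r| ≤
      2 * a * r * normalIntegral A ψ r := by
    have hx : 0 ≤ 18 * L * r := by positivity
    have hcmp := layer_comparison hdk hC11 hreg hbdd hn hnm h hr hLr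
    have hpow : ENNReal.ofReal (1 + 18 * L * r) ^ m ≤ ENNReal.ofReal (1 + a * r) := by
      rw [← ENNReal.ofReal_pow (by linarith)]
      refine ENNReal.ofReal_le_ofReal ((one_add_pow_le hx hLr m).trans (le_of_eq ?_))
      rw [ha]; ring
    have hmono : ∀ ν : Measure (EuclideanSpace ℝ (Fin d)),
        ENNReal.ofReal (1 + 18 * L * r) ^ m • ν ≤ ENNReal.ofReal (1 + a * r) • ν := fun ν => by
      refine Measure.le_iff.2 fun B _ => ?_
      rw [Measure.smul_apply, Measure.smul_apply, smul_eq_mul, smul_eq_mul]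
      gcongr
    rw [hE1, hE2]
    have := abs_integral_sub_integral_le (x := a * r) (by positivity)
      (hcmp.2.trans (hmono _)) (hcmp.1.trans (hmono _)) hg0 hI1 hI2
    rwa [← mul_assoc] at this
  refine ⟨?_, hIoc ▸ hI3, hmain, fun Ψ hΨ => ⟨fun hne => ?_, ?_⟩⟩
  · exact hI1.congr (ae_restrict_of_forall_mem hlayer fun y hy => hgψ (boundaryLayer_subset hy))
  · have : Nontrivial (EuclideanSpace ℝ (Fin d)) :=
      Module.nontrivial_of_finrank_pos (R := ℝ) (by rw [hfr]; omega)
    -- A nonempty bounded set has boundary points, and `Ψ` can be read off along the normal at a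
    -- single one.
    obtain ⟨z, hz⟩ : S.Nonempty := by
      refine nonempty_frontier_iff.2 ⟨hne, fun e => ?_⟩
      exact NormedSpace.unbounded_univ ℝ (EuclideanSpace ℝ (Fin d)) (e ▸ hbdd)
    rw [intervalIntegrable_iff_integrableOn_Ioo_of_le hr.le]
    have hc : Measurable fun s : ℝ => g (z + s • innerNormal A z) :=
      hgm.comp (by fun_prop)
    have hI : IntegrableOn (fun s : ℝ => g (z + s • innerNormal A z)) (Ioo 0 r) :=
      Integrable.of_bound hc.aestronglyMeasurable _ (ae_of_all _ fun s => hgM _)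
    refine hI.congr (ae_restrict_of_forall_mem measurableSet_Ioo fun s hs => ?_)
    dsimp only
    rw [hgψ (hmemA z hz s ⟨hs.1.le, (hs.2.trans hr₀).le⟩), hΨ z hz s ⟨hs.1, hs.2.trans hr₀⟩]
  · have e : normalIntegral A ψ r = perimeter A * ∫ s in (0 : ℝ)..r, Ψ s := by
      rw [normalIntegral, intervalIntegral.integral_of_le hr.le,
        intervalIntegral.integral_of_le hr.le, integral_Ioc_eq_integral_Ioo,
        integral_Ioc_eq_integral_Ioo, ← integral_const_mul]
      refine setIntegral_congr_fun measurableSet_Ioo fun s hs => ?_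
      have : ∫ z, ψ (z + s • innerNormal A z) ∂(surfaceMeasure A) =
          ∫ z, Ψ s ∂(surfaceMeasure A) := by
        refine setIntegral_congr_fun hcpt.measurableSet fun z hz => ?_
        exact hΨ z hz s ⟨hs.1, hs.2.trans hr₀⟩
      rw [this, integral_const, smul_eq_mul, perimeter]
    rw [← e]
    exact hmain
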